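/- **Setting.** Fix $p\in[1,\infty]$ and let $d_p$ be the $L_p$-metric on $\mathbb{R}^2$. An *axis-aligned highway cross* is a pair $h$ consisting of a vertical line $x=a$ and a horizontal line $y=b$ (the highways). The travel time between two points is the infimum, over all polygonal paths joining them, of the time needed to traverse the path, where a segment is traversed with speed $v$ if it runs along one of the two highways and with speed $1$ (with respect to $d_p$) otherwise; for infinite speed, $v=\infty$, segments running along a highway take time $0$. The *travel-time diameter* of $S\subset\mathbb{R}^2$ with respect to $h$ is the maximum travel time over all pairs of points of $S$ ($0$ if $S=\emptyset$), and $h$ is *optimal* for $S$ if its travel-time diameter is minimum among all axis-aligned highway crosses. An *enclosing cross* of $S$ of width $w\ge 0$ is the union of a vertical strip $\{|x-a|\le w/2\}$ and a horizontal strip $\{|y-b|\le w/2\}$ of equal width $w$ that contains $S$; the lines $x=a$ and $y=b$ are the middle lines of its strips. It is *smallest* if its width is minimum among all enclosing crosses of $S$. **Theorem.** (1) For every $p\in[1,\infty]$ and every finite set $S\subset\mathbb{R}^2$, a smallest enclosing cross of $S$ and an optimal axis-aligned highway cross of infinite speed for $S$ exist; the travel-time diameter of $S$ with respect to every optimal axis-aligned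 highway cross of infinite speed equals the width of the smallest enclosing crosses of $S$; and the middle lines of the strips of every smallest enclosing cross of $S$ form an optimal axis-aligned highway cross of infinite speed for $S$. (2) An optimal axis-aligned highway cross of infinite speed can be computed in $O(n\log n)$ time on a real RAM: there are a real-RAM program $P$ and a constant $K$ such that for every $n\ge 2$ and all points $q_0,\dots,q_{n-1}\in\mathbb{R}^2$, given $n$ and the coordinates of the points, $P$ halts after at most $K\,n\log n$ steps and outputs the middle lines and the width of a smallest enclosing cross of $S=\{q_0,\dots,q_{n-1}\}$; these middle lines form an optimal highway cross of infinite speed for $S$ for every $p\in[1,\infty]$, and its travel-time diameter equals the width. Here a real RAM has registers and arrays for real numbers with unit-time $+,-,\cdot,/$, comparison and rational constants (with $x/0=0$), and registers and arrays for natural numbers, used for addressing, with unit-time addition, (truncated) subtraction, halving with rounding down, comparison and constants; all natural numbers that $P$ writes to memory and all addresses to which it writes are at most $K n$. -/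

import Mathlib

open scoped ENNReal NNReal

noncomputable section

/-! ## Highway crosses and travel times -/

/-- The `L_p` distance of two points of the plane. -/
def lpDist (p : ℝ≥0∞) [Fact (1 ≤ p)] (u v : ℝ × ℝ) : ℝ≥0∞ :=
  edist (WithLp.toLp p u) (WithLp.toLp p v)

/-- An axis-aligned highway cross: the vertical line `x = xv` and the horizontal line `y = yh`. -/
structure HighwayCross where
  xv : ℝ
  yh : ℝ

namespace HighwayCross

/-- The vertical highway. -/
def vertical (h : HighwayCross) : Set (ℝ × ℝ) := {u | u.1 = h.xv}

/-- The horizontal highway. -/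
def horizontal (h : HighwayCross) : Set (ℝ × ℝ) := {u | u.2 = h.yh}

open Classical in
/-- The time to traverse the straight segment from `u` to `w`: it is traversed with the highway
speed `v` if it runs along one of the two highways, and with speed `1` otherwise (a segment that
does not run along a highway meets the highways in at most two points).
For infinite speed, `v = ∞`, the division gives `0`. -/
def legTime (h : HighwayCross) (p : ℝ≥0∞) [Fact (1 ≤ p)] (v : ℝ≥0∞) (u w : ℝ × ℝ) : ℝ≥0∞ :=
  if (u ∈ h.vertical ∧ w ∈ h.vertical) ∨ (u ∈ h.horizontal ∧ w ∈ h.horizontal) then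
    lpDist p u w / v
  else lpDist p u w

/-- The time to traverse the polygonal path that starts in `u`, visits the points of the list in
order, and ends in `w`. -/
def pathTime (h : HighwayCross) (p : ℝ≥0∞) [Fact (1 ≤ p)] (v : ℝ≥0∞) :
    ℝ × ℝ → List (ℝ × ℝ) → ℝ × ℝ → ℝ≥0∞
  | u, [], w => h.legTime p v u w
  | u, z :: l, w => h.legTime p v u z + pathTime h p v z l w

/-- The travel time from `u` to `w`: the time of a quickest (polygonal) path. -/
def travelTime (h : HighwayCross) (p : ℝ≥0∞) [Fact (1 ≤ p)] (v : ℝ≥0∞) (u w : ℝ × ℝ) : ℝ≥0∞ :=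
  ⨅ l : List (ℝ × ℝ), h.pathTime p v u l w

/-- The travel-time diameter of `S`: the maximum travel time over all pairs of points of `S`. -/
def travelTimeDiameter (h : HighwayCross) (p : ℝ≥0∞) [Fact (1 ≤ p)] (v : ℝ≥0∞)
    (S : Set (ℝ × ℝ)) : ℝ≥0∞ :=
  ⨆ u ∈ S, ⨆ w ∈ S, h.travelTime p v u w

/-- `h` is an optimal axis-aligned highway cross of speed `v` for `S`. -/
def IsOptimal (h : HighwayCross) (p : ℝ≥0∞) [Fact (1 ≤ p)] (v : ℝ≥0∞) (S : Set (ℝ × ℝ)) : Prop :=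
  ∀ h' : HighwayCross, h.travelTimeDiameter p v S ≤ h'.travelTimeDiameter p v S

end HighwayCross

/-! ## Enclosing crosses -/

/-- A vertical and a horizontal closed strip of equal width; `mid` consists of the middle lines of
the two strips. -/
structure StripCross where
  mid : HighwayCross
  width : ℝ≥0

namespace StripCross

def verticalStrip (C : StripCross) : Set (ℝ × ℝ) := {u | |u.1 - C.mid.xv| ≤ (C.width : ℝ) / 2}

def horizontalStrip (C : StripCross) : Set (ℝ × ℝ) := {u | |u.2 - C.mid.yh| ≤ (C.width : ℝ) / 2}

/-- The union of the two strips contains `S`. -/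
def Encloses (C : StripCross) (S : Set (ℝ × ℝ)) : Prop :=
  S ⊆ C.verticalStrip ∪ C.horizontalStrip

/-- `C` is a smallest enclosing cross of `S`: an enclosing cross of minimum width. -/
def IsSmallestEnclosing (C : StripCross) (S : Set (ℝ × ℝ)) : Prop :=
  C.Encloses S ∧ ∀ C' : StripCross, C'.Encloses S → C.width ≤ C'.width

end StripCross

/-! ## The real RAM

A program uses registers and arrays holding natural numbers, and registers and arrays holding real
numbers. Arrays are addressed by natural numbers; there is no conversion between real
and natural numbers. Every operation takes unit time. A program names only finitely many
registers and arrays, and is the same for all inputs. Natural numbers that are kept in memory are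
limited to a word of the machine. -/

namespace RealRAM

structure State where
  natReg : ℕ → ℕ
  realReg : ℕ → ℝ
  natArr : ℕ → ℕ → ℕ
  realArr : ℕ → ℕ → ℝ

namespace State

def setNatReg (s : State) (i k : ℕ) : State :=
  { s with natReg := Function.update s.natReg i k }

def setRealReg (s : State) (i : ℕ) (x : ℝ) : State :=
  { s with realReg := Function.update s.realReg i x }

def setNatArr (s : State) (a j k : ℕ) : State :=
  { s with natArr := Function.update s.natArr a (Function.update (s.natArr a) j k) }

def setRealArr (s : State) (a j : ℕ) (x : ℝ) : State :=
  { s with realArr := Function.update s.realArr a (Function.update (s.realArr a) j x) }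

end State

/-- Natural-number expressions: `get a e` reads cell `e` of the natural-number array `a`. -/
inductive NatExpr where
  | const (k : ℕ)
  | reg (i : ℕ)
  | get (a : ℕ) (e : NatExpr)
  | add (e f : NatExpr)
  | sub (e f : NatExpr)
  | half (e : NatExpr)

namespace NatExpr

def eval (s : State) : NatExpr → ℕ
  | const k => k
  | reg i => s.natReg i
  | get a e => s.natArr a (e.eval s)
  | add e f => e.eval s + f.eval s
  | sub e f => e.eval s - f.eval s
  | half e => e.eval s / 2

/-- The number of operations performed in the evaluation. -/
def cost : NatExpr → ℕ
  | const _ => 1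
  | reg _ => 1
  | get _ e => 1 + e.cost
  | add e f => 1 + e.cost + f.cost
  | sub e f => 1 + e.cost + f.cost
  | half e => 1 + e.cost

end NatExpr

/-- Real expressions: `get a e` reads cell `e` of the real array `a`. Only rational constants are
available. Division by zero returns `0`. -/
inductive RealExpr where
  | const (k : ℚ)
  | reg (i : ℕ)
  | get (a : ℕ) (e : NatExpr)
  | add (e f : RealExpr)
  | sub (e f : RealExpr)
  | mul (e f : RealExpr)
  | div (e f : RealExpr)

namespace RealExpr

def eval (s : State) : RealExpr → ℝ
  | const k => (k : ℝ)
  | reg i => s.realReg i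
  | get a e => s.realArr a (e.eval s)
  | add e f => e.eval s + f.eval s
  | sub e f => e.eval s - f.eval s
  | mul e f => e.eval s * f.eval s
  | div e f => e.eval s / f.eval s

/-- The number of operations performed in the evaluation. -/
def cost : RealExpr → ℕ
  | const _ => 1
  | reg _ => 1
  | get _ e => 1 + e.cost
  | add e f => 1 + e.cost + f.cost
  | sub e f => 1 + e.cost + f.cost
  | mul e f => 1 + e.cost + f.cost
  | div e f => 1 + e.cost + f.cost

end RealExpr

/-- Tests. -/
inductive Test where
  | natLE (e f : NatExpr)
  | realLE (e f : RealExpr)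
  | neg (b : Test)
  | conj (b c : Test)

namespace Test

def Holds (s : State) : Test → Prop
  | natLE e f => e.eval s ≤ f.eval s
  | realLE e f => e.eval s ≤ f.eval s
  | neg b => ¬ b.Holds s
  | conj b c => b.Holds s ∧ c.Holds s

/-- The number of operations performed in the evaluation. -/
def cost : Test → ℕ
  | natLE e f => 1 + e.cost + f.cost
  | realLE e f => 1 + e.cost + f.cost
  | neg b => 1 + b.cost
  | conj b c => 1 + b.cost + c.cost

end Test

/-- Programs. `putNat a j e` stores the value of `e` in cell `j` of the natural-number array `a`;
similarly for `putReal`. -/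
inductive Program where
  | skip
  | setNat (i : ℕ) (e : NatExpr)
  | setReal (i : ℕ) (e : RealExpr)
  | putNat (a : ℕ) (j e : NatExpr)
  | putReal (a : ℕ) (j : NatExpr) (e : RealExpr)
  | seq (P Q : Program)
  | ifThenElse (b : Test) (P Q : Program)
  | whileDo (b : Test) (P : Program)

/-- `Runs W P s t s'`: started in state `s`, the program `P` halts in state `s'` after `t` steps,
and on the way it writes only natural numbers that are at most `W` to registers and arrays, and
writes only to array cells whose address is at most `W`. -/
inductive Runs (W : ℕ) : Program → State → ℕ → State → Prop where
  | skip (s : State) : Runs W .skip s 1 s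
  | setNat (i : ℕ) (e : NatExpr) (s : State) (he : e.eval s ≤ W) :
      Runs W (.setNat i e) s (1 + e.cost) (s.setNatReg i (e.eval s))
  | setReal (i : ℕ) (e : RealExpr) (s : State) :
      Runs W (.setReal i e) s (1 + e.cost) (s.setRealReg i (e.eval s))
  | putNat (a : ℕ) (j e : NatExpr) (s : State) (hj : j.eval s ≤ W) (he : e.eval s ≤ W) :
      Runs W (.putNat a j e) s (1 + j.cost + e.cost) (s.setNatArr a (j.eval s) (e.eval s))
  | putReal (a : ℕ) (j : NatExpr) (e : RealExpr) (s : State) (hj : j.eval s ≤ W) :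
      Runs W (.putReal a j e) s (1 + j.cost + e.cost) (s.setRealArr a (j.eval s) (e.eval s))
  | seq (P Q : Program) (s s' s'' : State) (t t' : ℕ) (hP : Runs W P s t s')
      (hQ : Runs W Q s' t' s'') : Runs W (.seq P Q) s (t + t') s''
  | ifTrue (b : Test) (P Q : Program) (s s' : State) (t : ℕ) (hb : b.Holds s)
      (hP : Runs W P s t s') : Runs W (.ifThenElse b P Q) s (1 + b.cost + t) s'
  | ifFalse (b : Test) (P Q : Program) (s s' : State) (t : ℕ) (hb : ¬ b.Holds s)
      (hQ : Runs W Q s t s') : Runs W (.ifThenElse b P Q) s (1 + b.cost + t) s'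
  | whileTrue (b : Test) (P : Program) (s s' s'' : State) (t t' : ℕ) (hb : b.Holds s)
      (hP : Runs W P s t s') (hw : Runs W (.whileDo b P) s' t' s'') :
      Runs W (.whileDo b P) s (1 + b.cost + t + t') s''
  | whileFalse (b : Test) (P : Program) (s : State) (hb : ¬ b.Holds s) :
      Runs W (.whileDo b P) s (1 + b.cost) s

/-- The machine is deterministic: a program has at most one halting run from a given state. -/
theorem Runs.unique {W : ℕ} {P : Program} {s s₁ s₂ : State} {t₁ t₂ : ℕ}
    (h₁ : Runs W P s t₁ s₁) (h₂ : Runs W P s t₂ s₂) : t₁ = t₂ ∧ s₁ = s₂ := by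
  induction h₁ generalizing t₂ s₂ with
  | seq P Q s s' s'' t t' _ _ ihP ihQ =>
    cases h₂ with
    | seq _ _ _ r _ _ _ hP hQ =>
      obtain ⟨rfl, rfl⟩ := ihP hP
      obtain ⟨rfl, rfl⟩ := ihQ hQ
      exact ⟨rfl, rfl⟩
  | ifTrue b P Q s s' t hb _ ih =>
    cases h₂ with
    | ifTrue _ _ _ _ _ _ _ hP => obtain ⟨rfl, rfl⟩ := ih hP; exact ⟨rfl, rfl⟩
    | ifFalse _ _ _ _ _ _ hb' => exact absurd hb hb'
  | ifFalse b P Q s s' t hb _ ih =>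
    cases h₂ with
    | ifTrue _ _ _ _ _ _ hb' => exact absurd hb' hb
    | ifFalse _ _ _ _ _ _ _ hQ => obtain ⟨rfl, rfl⟩ := ih hQ; exact ⟨rfl, rfl⟩
  | whileTrue b P s s' s'' t t' hb _ _ ihP ihw =>
    cases h₂ with
    | whileTrue _ _ _ _ _ _ _ _ hP hw =>
      obtain ⟨rfl, rfl⟩ := ihP hP
      obtain ⟨rfl, rfl⟩ := ihw hw
      exact ⟨rfl, rfl⟩
    | whileFalse _ _ _ hb' => exact absurd hb hb'
  | whileFalse b P s hb =>
    cases h₂ with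
    | whileTrue _ _ _ _ _ _ _ hb' => exact absurd hb' hb
    | whileFalse => exact ⟨rfl, rfl⟩
  | _ => cases h₂; exact ⟨rfl, rfl⟩

/-- The initial state for the input `q 0, …, q (n - 1)`: natural-number register `0` holds `n`,
the real arrays `0` and `1` hold the `x`- and the `y`-coordinates, and everything else is `0`. -/
def inputState {n : ℕ} (q : Fin n → ℝ × ℝ) : State where
  natReg i := if i = 0 then n else 0
  realReg _ := 0
  natArr _ _ := 0
  realArr a j :=
    if hj : j < n then
      if a = 0 then (q ⟨j, hj⟩).1 else if a = 1 then (q ⟨j, hj⟩).2 else 0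
    else 0

/-- The state `s` presents the cross `C` as output: the real registers `0`, `1`, `2` hold the
position of the middle line of the vertical strip, that of the horizontal strip, and the width. -/
def Outputs (s : State) (C : StripCross) : Prop :=
  s.realReg 0 = C.mid.xv ∧ s.realReg 1 = C.mid.yh ∧ s.realReg 2 = (C.width : ℝ)

end RealRAM

end

/-! ## Distances in the plane -/

section Distances

variable (p : ℝ≥0∞) [Fact (1 ≤ p)]

/-! At infinite speed only the distance `distTo` to the cross matters. A nearest point of the cross
lies straight across or straight above or below, so this distance does not depend on `p`. Travelling
to the cross, along it, and off again takes `distTo u + distTo w` (`travelTime_le`). A path that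
uses no highway takes at least `lpDist p u w`, so the minimum of the two quantities is a lower bound
(`min_le_travelTime`).

Hence the middle lines of an enclosing cross of width `r` have diameter at most `r`: every point is
within `r / 2` of them. For the converse (`exists_encloses_of_diameter_le`), let `h` have diameter
at most `r` and let `u` be a point of `S` farthest from `h`, at distance `D`. If `D ≤ r / 2`, then
`h` itself is the middle of an enclosing cross. Otherwise shift both strips towards `u`, so that
their outer sides are at distance `D` from the highways. Each other point is either within `r` of
`u` in both coordinates or within `r - D` of `h`, and in both cases one of the shifted strips
contains it. So the minimum diameter equals the minimum width.

To compute the width, sort the points by abscissa. It suffices to consider vertical strips that span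
a window of indices `i` to `j`, with the horizontal strip covering the ordinates of the points
outside; the cross has width `spanWidth`, the maximum of the spread of the window and the height
outside it. For a fixed left end, moving the right end outward cannot decrease the spread; for a
fixed right end, moving the left end inward cannot decrease the height. So one of the two pointers
can always advance without losing a better window (`SweepInv.advance_left`,
`SweepInv.advance_right`), and linearly many windows suffice. Prefix and suffix extrema give each
height in constant time.

The program is a bottom-up merge sort followed by this sweep. Its loops are verified with an
invariant and a potential that pays for the running time (`runs_whileDo`), its loop-free pieces by
symbolic execution (`Program.runs_exec`). Since the program halts with a smallest cross on every
input, its correctness also yields the existence of smallest crosses. -/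

theorem lpDist_triangle (u z w : ℝ × ℝ) : lpDist p u w ≤ lpDist p u z + lpDist p z w :=
  edist_triangle _ _ _

theorem edist_fst_le_lpDist (u w : ℝ × ℝ) : edist u.1 w.1 ≤ lpDist p u w :=
  WithLp.edist_fst_le (WithLp.toLp p u) (WithLp.toLp p w)

theorem edist_snd_le_lpDist (u w : ℝ × ℝ) : edist u.2 w.2 ≤ lpDist p u w :=
  WithLp.edist_snd_le (WithLp.toLp p u) (WithLp.toLp p w)

theorem lpDist_comm (u w : ℝ × ℝ) : lpDist p u w = lpDist p w u :=
  edist_comm _ _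

theorem lpDist_horizontal (a b c : ℝ) : lpDist p (a, c) (b, c) = edist a b := by
  rw [← WithLp.edist_toLp_fst p ℝ ℝ a b, lpDist, edist_eq_enorm_sub, edist_eq_enorm_sub,
    ← WithLp.toLp_sub, ← WithLp.toLp_sub, Prod.mk_sub_mk, Prod.mk_sub_mk, sub_self, sub_self]

theorem lpDist_vertical (a b c : ℝ) : lpDist p (c, a) (c, b) = edist a b := by
  rw [← WithLp.edist_toLp_snd p ℝ ℝ a b, lpDist, edist_eq_enorm_sub, edist_eq_enorm_sub,
    ← WithLp.toLp_sub, ← WithLp.toLp_sub, Prod.mk_sub_mk, Prod.mk_sub_mk, sub_self, sub_self]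

end Distances

/-! ## Travel times at infinite speed -/

namespace HighwayCross

/-- The distance from a point to the cross (which is the same for all `L_p` metrics). -/
noncomputable def distTo (h : HighwayCross) (u : ℝ × ℝ) : ℝ≥0∞ :=
  min (edist u.1 h.xv) (edist u.2 h.yh)

variable (h : HighwayCross) (p : ℝ≥0∞) [Fact (1 ≤ p)]

theorem distTo_le_lpDist_add (u z : ℝ × ℝ) : h.distTo u ≤ lpDist p u z + h.distTo z := by
  rcases min_choice (edist z.1 h.xv) (edist z.2 h.yh) with hz | hz
  · rw [distTo, distTo, hz]
    exact (min_le_left _ _).trans ((edist_triangle _ z.1 _).trans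
      (by gcongr; exact edist_fst_le_lpDist p u z))
  · rw [distTo, distTo, hz]
    exact (min_le_right _ _).trans ((edist_triangle _ z.2 _).trans
      (by gcongr; exact edist_snd_le_lpDist p u z))

theorem distTo_eq_zero {u : ℝ × ℝ} (hu : u ∈ h.vertical ∨ u ∈ h.horizontal) :
    h.distTo u = 0 := by
  rcases hu with hu | hu
  · exact le_antisymm ((min_le_left _ _).trans (by rw [show u.1 = h.xv from hu, edist_self])) bot_le
  · exact le_antisymm ((min_le_right _ _).trans (by rw [show u.2 = h.yh from hu, edist_self]))
      bot_le

theorem legTime_le_lpDist (u w : ℝ × ℝ) : h.legTime p ∞ u w ≤ lpDist p u w := by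
  unfold legTime
  split_ifs
  · simp
  · exact le_rfl

theorem legTime_eq_zero {u w : ℝ × ℝ}
    (huw : (u ∈ h.vertical ∧ w ∈ h.vertical) ∨ (u ∈ h.horizontal ∧ w ∈ h.horizontal)) :
    h.legTime p ∞ u w = 0 := by
  rw [legTime, if_pos huw, ENNReal.div_top]

/-- The induction step for paths. A leg along a highway is free, but both its ends have distance `0`
to the cross, so the bound for `u` reduces to `h.distTo w`. Any other leg costs its length, and the
triangle inequality handles both terms of the minimum. -/
theorem min_le_legTime_add (u z w : ℝ × ℝ) (x : ℝ≥0∞)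
    (hx : min (lpDist p z w) (h.distTo z + h.distTo w) ≤ x) :
    min (lpDist p u w) (h.distTo u + h.distTo w) ≤ h.legTime p ∞ u z + x := by
  by_cases huz : (u ∈ h.vertical ∧ z ∈ h.vertical) ∨ (u ∈ h.horizontal ∧ z ∈ h.horizontal)
  · have hu : h.distTo u = 0 := h.distTo_eq_zero (huz.imp And.left And.left)
    have hz : h.distTo z = 0 := h.distTo_eq_zero (huz.imp And.right And.right)
    rw [h.legTime_eq_zero p huz, zero_add]
    rw [hz, zero_add] at hx
    rw [hu, zero_add]
    refine le_trans (le_trans (min_le_right _ _) (le_min ?_ le_rfl)) hx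
    have := h.distTo_le_lpDist_add p w z
    rwa [hz, add_zero, lpDist_comm] at this
  · rw [legTime, if_neg huz]
    refine le_trans ?_ (add_le_add_right hx _)
    rw [← min_add_add_left]
    refine min_le_min (lpDist_triangle p u z w) ?_
    rw [← add_assoc]
    gcongr
    exact h.distTo_le_lpDist_add p u z

theorem min_le_pathTime (l : List (ℝ × ℝ)) (u w : ℝ × ℝ) :
    min (lpDist p u w) (h.distTo u + h.distTo w) ≤ h.pathTime p ∞ u l w := by
  induction l generalizing u with
  | nil =>
    simpa [pathTime, HighwayCross.distTo_le_lpDist_add] using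
      h.min_le_legTime_add p u w w 0 (by simp [lpDist])
  | cons z l ih => exact h.min_le_legTime_add p u z w _ (ih z)

theorem min_le_travelTime (u w : ℝ × ℝ) :
    min (lpDist p u w) (h.distTo u + h.distTo w) ≤ h.travelTime p ∞ u w :=
  le_iInf fun l => h.min_le_pathTime p l u w

theorem exists_nearest (u : ℝ × ℝ) :
    ∃ z, (z ∈ h.vertical ∨ z ∈ h.horizontal) ∧ lpDist p u z = h.distTo u := by
  rcases min_choice (edist u.1 h.xv) (edist u.2 h.yh) with hu | hu
  · exact ⟨(h.xv, u.2), Or.inl rfl, by rw [distTo, hu]; exact lpDist_horizontal p u.1 h.xv u.2⟩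
  · exact ⟨(u.1, h.yh), Or.inr rfl, by rw [distTo, hu]; exact lpDist_vertical p u.2 h.yh u.1⟩

theorem travelTime_le (u w : ℝ × ℝ) : h.travelTime p ∞ u w ≤ h.distTo u + h.distTo w := by
  obtain ⟨z, hz, huz⟩ := h.exists_nearest p u
  obtain ⟨z', hz', hwz'⟩ := h.exists_nearest p w
  have hc : (h.xv, h.yh) ∈ h.vertical ∧ (h.xv, h.yh) ∈ h.horizontal := ⟨rfl, rfl⟩
  -- The crossing point lies on both highways, so passing through it makes the two middle legs free
  -- whichever highways `z` and `z'` lie on.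
  refine (iInf_le _ [z, (h.xv, h.yh), z']).trans ?_
  have h1 : h.legTime p ∞ z (h.xv, h.yh) = 0 :=
    h.legTime_eq_zero p (hz.imp (⟨·, hc.1⟩) (⟨·, hc.2⟩))
  have h2 : h.legTime p ∞ (h.xv, h.yh) z' = 0 :=
    h.legTime_eq_zero p (hz'.imp (⟨hc.1, ·⟩) (⟨hc.2, ·⟩))
  simp only [pathTime, h1, h2, zero_add]
  rw [← huz, ← hwz', lpDist_comm p w z']
  exact add_le_add (h.legTime_le_lpDist p _ _) (h.legTime_le_lpDist p _ _)

end HighwayCross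

/-! ## Enclosing crosses and the travel-time diameter -/

theorem edist_le_ofReal_iff {a b r : ℝ} (hr : 0 ≤ r) :
    edist a b ≤ ENNReal.ofReal r ↔ |a - b| ≤ r := by
  rw [edist_dist, ENNReal.ofReal_le_ofReal_iff hr, Real.dist_eq]

namespace HighwayCross

variable (h : HighwayCross) (p : ℝ≥0∞) [Fact (1 ≤ p)]

theorem toReal_distTo (u : ℝ × ℝ) : (h.distTo u).toReal = min |u.1 - h.xv| |u.2 - h.yh| := by
  rw [distTo, ENNReal.toReal_min (edist_ne_top _ _) (edist_ne_top _ _), edist_dist, edist_dist,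
    ENNReal.toReal_ofReal dist_nonneg, ENNReal.toReal_ofReal dist_nonneg, Real.dist_eq,
    Real.dist_eq]

theorem distTo_ne_top (u : ℝ × ℝ) : h.distTo u ≠ ∞ :=
  ((min_le_left _ _).trans_lt (edist_lt_top _ _)).ne

theorem travelTime_le_diameter {S : Set (ℝ × ℝ)} {v : ℝ≥0∞} {u w : ℝ × ℝ} (hu : u ∈ S)
    (hw : w ∈ S) : h.travelTime p v u w ≤ h.travelTimeDiameter p v S :=
  le_iSup₂_of_le u hu (le_iSup₂_of_le w hw le_rfl)

/-- Two points whose travel time is at most `r` are near each other or near the cross. -/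
theorem close_or_near_of_travelTime_le {u w : ℝ × ℝ} {r : ℝ≥0}
    (hr : h.travelTime p ∞ u w ≤ r) :
    (|u.1 - w.1| ≤ r ∧ |u.2 - w.2| ≤ r) ∨
      min |u.1 - h.xv| |u.2 - h.yh| + min |w.1 - h.xv| |w.2 - h.yh| ≤ r := by
  rcases min_le_iff.1 ((h.min_le_travelTime p u w).trans hr) with hd | hd
  · left
    rw [← ENNReal.ofReal_coe_nnreal] at hd
    exact ⟨(edist_le_ofReal_iff r.2).1 ((edist_fst_le_lpDist p u w).trans hd),
      (edist_le_ofReal_iff r.2).1 ((edist_snd_le_lpDist p u w).trans hd)⟩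
  · right
    rw [← toReal_distTo, ← toReal_distTo, ← ENNReal.toReal_add (h.distTo_ne_top u)
      (h.distTo_ne_top w)]
    exact ENNReal.toReal_mono ENNReal.coe_ne_top hd

/-- The strip of width `r` that ends at distance `D` from `a`, on the side of `x`. -/
theorem exists_strip_mid (x a D r : ℝ) (hx : D ≤ |x - a|) :
    ∃ c : ℝ, ∀ z : ℝ, (|x - z| ≤ r ∨ |z - a| ≤ r - D) → |z - a| ≤ D → |z - c| ≤ r / 2 := by
  rcases le_total 0 (x - a) with hxa | hxa
  -- The strip is `[a + D - r, a + D]`. Its left end bounds `z` from below in both cases: `x - r ≥ a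
  -- + D - r`, and `a - (r - D)` equals it.
  · refine ⟨a + D - r / 2, fun z hz hz' => ?_⟩
    rw [abs_of_nonneg hxa] at hx
    rw [abs_le] at hz' ⊢
    rcases hz with hz | hz <;> rw [abs_le] at hz <;> constructor <;> linarith
  · refine ⟨a - D + r / 2, fun z hz hz' => ?_⟩
    rw [abs_of_nonpos hxa] at hx
    rw [abs_le] at hz' ⊢
    rcases hz with hz | hz <;> rw [abs_le] at hz <;> constructor <;> linarith

end HighwayCross

namespace HighwayCross

variable (h : HighwayCross) (p : ℝ≥0∞) [Fact (1 ≤ p)]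

/-- A set of travel-time diameter at most `r` has an enclosing cross of width `r`. -/
theorem exists_encloses_of_diameter_le {S : Set (ℝ × ℝ)} (hS : S.Finite) {r : ℝ≥0}
    (hr : h.travelTimeDiameter p ∞ S ≤ r) : ∃ c : HighwayCross, StripCross.Encloses ⟨c, r⟩ S := by
  rcases S.eq_empty_or_nonempty with rfl | hne
  · exact ⟨h, Set.empty_subset _⟩
  -- Finiteness of `S` is needed for a farthest point.
  obtain ⟨u, hu, hmax⟩ := hS.exists_maximalFor (fun u => min |u.1 - h.xv| |u.2 - h.yh|) S hne
  replace hmax : ∀ w ∈ S, min |w.1 - h.xv| |w.2 - h.yh| ≤ min |u.1 - h.xv| |u.2 - h.yh| :=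
    fun w hw => (le_total _ _).elim id (hmax hw)
  set D := min |u.1 - h.xv| |u.2 - h.yh| with hD
  rcases le_or_gt D (r / 2) with hDr | hDr
  · exact ⟨h, fun w hw => min_le_iff.1 ((hmax w hw).trans hDr)⟩
  obtain ⟨a, ha⟩ := exists_strip_mid u.1 h.xv D r (min_le_left _ _)
  obtain ⟨b, hb⟩ := exists_strip_mid u.2 h.yh D r (min_le_right _ _)
  refine ⟨⟨a, b⟩, fun w hw => ?_⟩
  rcases h.close_or_near_of_travelTime_le p ((h.travelTime_le_diameter p hu hw).trans hr) with
    ⟨h1, h2⟩ | hn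
  -- A point close to `u` is close in both coordinates; whichever highway is within `D` of it
  -- determines the strip that contains it.
  · exact (min_le_iff.1 (hmax w hw)).imp (ha w.1 (Or.inl h1)) (hb w.2 (Or.inl h2))
  · rw [← hD, ← le_sub_iff_add_le', min_le_iff] at hn
    exact hn.imp (fun h1 => ha w.1 (Or.inr h1) (by linarith))
      (fun h1 => hb w.2 (Or.inr h1) (by linarith))

/-- The middle lines of an enclosing cross give a travel-time diameter of at most its width. -/
theorem diameter_le_of_encloses {S : Set (ℝ × ℝ)} {r : ℝ≥0} (hS : StripCross.Encloses ⟨h, r⟩ S) :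
    h.travelTimeDiameter p ∞ S ≤ r := by
  have key : ∀ u ∈ S, h.distTo u ≤ ENNReal.ofReal (r / 2) := fun u hu => by
    rw [distTo, min_le_iff, edist_le_ofReal_iff (by positivity),
      edist_le_ofReal_iff (by positivity)]
    exact hS hu
  refine iSup₂_le fun u hu => iSup₂_le fun w hw => (h.travelTime_le p u w).trans ?_
  refine (add_le_add (key u hu) (key w hw)).trans ?_
  rw [← ENNReal.ofReal_add (by positivity) (by positivity), add_halves, ENNReal.ofReal_coe_nnreal]

end HighwayCross

namespace StripCross.IsSmallestEnclosing

variable {C : StripCross} {S : Set (ℝ × ℝ)} (p : ℝ≥0∞) [Fact (1 ≤ p)]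

theorem width_le_diameter (hC : C.IsSmallestEnclosing S) (hS : S.Finite) (h : HighwayCross) :
    (C.width : ℝ≥0∞) ≤ h.travelTimeDiameter p ∞ S := by
  -- Comparing with all upper bounds `r` of the diameter avoids having to show first that it is
  -- finite.
  refine le_of_forall_ge fun r hr => ?_
  induction r with
  | top => exact le_top
  | coe r =>
    obtain ⟨c, hc⟩ := h.exists_encloses_of_diameter_le p hS hr
    exact ENNReal.coe_le_coe.2 (hC.2 _ hc)

theorem diameter_eq_width (hC : C.IsSmallestEnclosing S) (hS : S.Finite) :
    C.mid.travelTimeDiameter p ∞ S = C.width :=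
  le_antisymm (C.mid.diameter_le_of_encloses p hC.1) (hC.width_le_diameter p hS C.mid)

theorem isOptimal (hC : C.IsSmallestEnclosing S) (hS : S.Finite) : C.mid.IsOptimal p ∞ S :=
  fun h => (hC.diameter_eq_width p hS).trans_le (hC.width_le_diameter p hS h)

end StripCross.IsSmallestEnclosing

/-! ## The sweep over the points sorted by abscissa -/

/-- The first components of `A lo, …, A (hi - 1)` are nondecreasing. -/
def SortedOn (A : ℕ → ℝ × ℝ) (lo hi : ℕ) : Prop :=
  ∀ i j, lo ≤ i → i ≤ j → j < hi → (A i).1 ≤ (A j).1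

/-- `top i j` and `bot i j` bound the ordinates of the points before `i` and after `j`, tightly. -/
structure IsEnvelope (n : ℕ) (A : ℕ → ℝ × ℝ) (top bot : ℕ → ℕ → ℝ) : Prop where
  le_top : ∀ i j k, k < n → k < i ∨ j < k → (A k).2 ≤ top i j
  bot_le : ∀ i j k, k < n → k < i ∨ j < k → bot i j ≤ (A k).2
  tight : ∀ i j, i ≤ n → j < n → ∀ c r : ℝ, 0 ≤ r →
    (∀ k < n, k < i ∨ j < k → |(A k).2 - c| ≤ r / 2) → top i j - bot i j ≤ r
  mono : ∀ i i' j, i ≤ i' → i' ≤ n → j < n → top i j - bot i j ≤ top i' j - bot i' j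

/-- The width of the cross whose vertical strip spans the points `i` to `j`. -/
noncomputable def spanWidth (A : ℕ → ℝ × ℝ) (top bot : ℕ → ℕ → ℝ) (i j : ℕ) : ℝ :=
  max ((A j).1 - (A i).1) (top i j - bot i j)

section Sweep

variable {n : ℕ} {A : ℕ → ℝ × ℝ} {top bot : ℕ → ℕ → ℝ}

theorem IsEnvelope.encloses (hA : SortedOn A 0 n) (hE : IsEnvelope n A top bot) {i j : ℕ}
    (hj : j < n) {k : ℕ} (hk : k < n) :
    |(A k).1 - ((A i).1 + (A j).1) / 2| ≤ spanWidth A top bot i j / 2 ∨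
      |(A k).2 - (top i j + bot i j) / 2| ≤ spanWidth A top bot i j / 2 := by
  have h1 : (A j).1 - (A i).1 ≤ spanWidth A top bot i j := le_max_left _ _
  have h2 : top i j - bot i j ≤ spanWidth A top bot i j := le_max_right _ _
  by_cases hkij : k < i ∨ j < k
  · right
    have h3 := hE.le_top i j k hk hkij
    have h4 := hE.bot_le i j k hk hkij
    rw [abs_le]; constructor <;> linarith
  · left
    push Not at hkij
    have h3 := hA i k (Nat.zero_le _) hkij.1 hk
    have h4 := hA k j (Nat.zero_le _) hkij.2 hj
    rw [abs_le]; constructor <;> linarith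

/-- Shrink the vertical strip to the window from the first to the last point that it contains; every
point outside the window must then lie in the horizontal strip. -/
theorem IsEnvelope.exists_spanWidth_le (hE : IsEnvelope n A top bot) (hn : 0 < n)
    {a b r : ℝ} (hr : 0 ≤ r) (h : ∀ k < n, |(A k).1 - a| ≤ r / 2 ∨ |(A k).2 - b| ≤ r / 2) :
    ∃ i j, i < n ∧ j < n ∧ spanWidth A top bot i j ≤ r := by
  classical
  let V := (Finset.range n).filter fun k => |(A k).1 - a| ≤ r / 2
  rcases V.eq_empty_or_nonempty with hV | hV
  -- If the vertical strip is empty, all points lie in the horizontal one, and any one-point window,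
  -- of spread `0`, will do.
  · refine ⟨0, 0, hn, hn, max_le (by simpa using hr) (hE.tight 0 0 hn.le hn b r hr ?_)⟩
    intro k hk _
    refine (h k hk).resolve_left fun hka => ?_
    have : k ∈ V := by simp [V, hk, hka]
    simp [hV] at this
  · have hi := V.min'_mem hV
    have hj := V.max'_mem hV
    have hmem : ∀ k, k ∈ V ↔ k < n ∧ |(A k).1 - a| ≤ r / 2 := fun k => by simp [V]
    rw [hmem] at hi hj
    refine ⟨_, _, hi.1, hj.1, max_le ?_ (hE.tight _ _ hi.1.le hj.1 b r hr ?_)⟩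
    · have h1 := abs_le.1 hi.2
      have h2 := abs_le.1 hj.2
      linarith
    · intro k hk hkij
      refine (h k hk).resolve_left fun hka => ?_
      have hkV : k ∈ V := (hmem k).2 ⟨hk, hka⟩
      rcases hkij with hlt | hlt
      · exact absurd (V.min'_le k hkV) (not_le.2 hlt)
      · exact absurd (V.le_max' k hkV) (not_le.2 hlt)

/-- The cross with middle lines `x = a`, `y = b` and width `r` encloses the points, and no window
that starts before `i` or ends before `j` gives a narrower one. -/
structure SweepInv (n : ℕ) (A : ℕ → ℝ × ℝ) (top bot : ℕ → ℕ → ℝ) (i j : ℕ) (a b r : ℝ) :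
    Prop where
  i_le : i ≤ n
  j_le : j ≤ n
  encloses : ∀ k < n, |(A k).1 - a| ≤ r / 2 ∨ |(A k).2 - b| ≤ r / 2
  minimal : ∀ i' j', i' < n → j' < n → i' < i ∨ j' < j → r ≤ spanWidth A top bot i' j'

namespace SweepInv

variable {i j : ℕ} {a b r : ℝ}

/-- The sweep has to start from a genuine enclosing cross: one vertical strip over all points, with
an arbitrary horizontal line. -/
theorem of_span (hA : SortedOn A 0 n) (hn : 0 < n) :
    SweepInv n A top bot 0 0 (((A 0).1 + (A (n - 1)).1) / 2) 0 ((A (n - 1)).1 - (A 0).1) where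
  i_le := Nat.zero_le _
  j_le := Nat.zero_le _
  encloses k hk := by
    left
    have h1 := hA 0 k le_rfl (Nat.zero_le _) hk
    have h2 := hA k (n - 1) (Nat.zero_le _) (by omega) (by omega)
    rw [abs_le]; constructor <;> linarith
  minimal _ _ _ _ h := by omega

theorem improve (h : SweepInv n A top bot i j a b r) (hA : SortedOn A 0 n)
    (hE : IsEnvelope n A top bot) (hj : j < n) (hr : spanWidth A top bot i j < r) :
    SweepInv n A top bot i j (((A i).1 + (A j).1) / 2) ((top i j + bot i j) / 2)
      (spanWidth A top bot i j) where
  i_le := h.i_le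
  j_le := h.j_le
  encloses _ hk := hE.encloses hA hj hk
  minimal i' j' hi' hj' hij := hr.le.trans (h.minimal i' j' hi' hj' hij)

/-- When the spread dominates, every window from `i` to some `j' ≥ j` has at least this spread, so
no window starting at `i` can beat `r`. -/
theorem advance_left (h : SweepInv n A top bot i j a b r) (hA : SortedOn A 0 n) (hi : i < n)
    (hr : r ≤ spanWidth A top bot i j) (hij : top i j - bot i j ≤ (A j).1 - (A i).1) :
    SweepInv n A top bot (i + 1) j a b r where
  i_le := hi
  j_le := h.j_le
  encloses := h.encloses
  minimal i' j' hi' hj' hlt := by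
    by_cases hlt' : i' < i ∨ j' < j
    · exact h.minimal i' j' hi' hj' hlt'
    · obtain rfl : i' = i := by omega
      rw [spanWidth, max_eq_left hij] at hr
      have := hA j j' (Nat.zero_le _) (by omega) hj'
      exact hr.trans ((sub_le_sub_right this _).trans (le_max_left _ _))

/-- When the height dominates, starting at `i' ≥ i` only adds outside points, so no window ending at
`j` can beat `r`. -/
theorem advance_right (h : SweepInv n A top bot i j a b r) (hE : IsEnvelope n A top bot)
    (hj : j < n) (hr : r ≤ spanWidth A top bot i j)
    (hij : (A j).1 - (A i).1 ≤ top i j - bot i j) :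
    SweepInv n A top bot i (j + 1) a b r where
  i_le := h.i_le
  j_le := hj
  encloses := h.encloses
  minimal i' j' hi' hj' hlt := by
    by_cases hlt' : i' < i ∨ j' < j
    · exact h.minimal i' j' hi' hj' hlt'
    · obtain rfl : j' = j := by omega
      rw [spanWidth, max_eq_right hij] at hr
      exact hr.trans ((hE.mono i i' j' (by omega) hi'.le hj').trans (le_max_right _ _))

theorem nonneg (h : SweepInv n A top bot i j a b r) (hn : 0 < n) : 0 ≤ r := by
  rcases h.encloses 0 hn with h0 | h0 <;> linarith [(abs_nonneg _).trans h0]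

/-- Once either pointer has reached `n`, every window is covered by `minimal`, and some window is no
wider than any given enclosing cross. -/
theorem isSmallestEnclosing (h : SweepInv n A top bot i j a b r) (hE : IsEnvelope n A top bot)
    (hn : 0 < n) (hij : n ≤ i ∨ n ≤ j) {w : ℝ≥0} (hw : (w : ℝ) = r) :
    StripCross.IsSmallestEnclosing ⟨⟨a, b⟩, w⟩ (A '' Set.Ico 0 n) := by
  constructor
  · rintro _ ⟨k, hk, rfl⟩
    simpa [StripCross.verticalStrip, StripCross.horizontalStrip, hw] using h.encloses k hk.2
  · intro C hC
    obtain ⟨i', j', hi', hj', hle⟩ := hE.exists_spanWidth_le hn C.width.2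
      (fun k hk => hC ⟨k, ⟨Nat.zero_le _, hk⟩, rfl⟩)
    rw [← NNReal.coe_le_coe]
    exact hw.trans_le ((h.minimal i' j' hi' hj' (by omega)).trans hle)

end SweepInv

end Sweep

/-! ## Running extrema -/

/-- The maximum of `a`, `y 0`, …, `y (i - 1)`. -/
noncomputable def prefixMax (a : ℝ) (y : ℕ → ℝ) : ℕ → ℝ
  | 0 => a
  | i + 1 => max (prefixMax a y i) (y i)

/-- The minimum of `a`, `y 0`, …, `y (i - 1)`. -/
noncomputable def prefixMin (a : ℝ) (y : ℕ → ℝ) : ℕ → ℝ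
  | 0 => a
  | i + 1 => min (prefixMin a y i) (y i)

theorem prefixMax_mono (a : ℝ) (y : ℕ → ℝ) : Monotone (prefixMax a y) :=
  monotone_nat_of_le_succ fun _ => le_max_left _ _

theorem prefixMin_anti (a : ℝ) (y : ℕ → ℝ) : Antitone (prefixMin a y) :=
  antitone_nat_of_succ_le fun _ => min_le_left _ _

theorem le_prefixMax (a : ℝ) (y : ℕ → ℝ) {k i : ℕ} (h : k < i) : y k ≤ prefixMax a y i :=
  (le_max_right _ _).trans (prefixMax_mono a y (Nat.succ_le_of_lt h))

theorem prefixMin_le (a : ℝ) (y : ℕ → ℝ) {k i : ℕ} (h : k < i) : prefixMin a y i ≤ y k :=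
  (prefixMin_anti a y (Nat.succ_le_of_lt h)).trans (min_le_right _ _)

theorem prefixMax_le {a c : ℝ} {y : ℕ → ℝ} {i : ℕ} (ha : a ≤ c) (h : ∀ k < i, y k ≤ c) :
    prefixMax a y i ≤ c := by
  induction i with
  | zero => exact ha
  | succ i ih => exact max_le (ih fun k hk => h k (by omega)) (h i (by omega))

theorem le_prefixMin {a c : ℝ} {y : ℕ → ℝ} {i : ℕ} (ha : c ≤ a) (h : ∀ k < i, c ≤ y k) :
    c ≤ prefixMin a y i := by
  induction i with
  | zero => exact ha
  | succ i ih => exact le_min (ih fun k hk => h k (by omega)) (h i (by omega))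

/-- `U k` is the maximum and `L k` the minimum of `y k`, …, `y (n - 1)` for `m ≤ k < n`. -/
structure IsSuffixExtrema (n m : ℕ) (y U L : ℕ → ℝ) : Prop where
  le_max : ∀ k j, m ≤ k → k ≤ j → j < n → y j ≤ U k
  min_le : ∀ k j, m ≤ k → k ≤ j → j < n → L k ≤ y j
  max_le : ∀ k, m ≤ k → k < n → ∀ c, (∀ j, k ≤ j → j < n → y j ≤ c) → U k ≤ c
  le_min : ∀ k, m ≤ k → k < n → ∀ c, (∀ j, k ≤ j → j < n → c ≤ y j) → c ≤ L k

namespace IsSuffixExtrema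

theorem last {n : ℕ} {y U L : ℕ → ℝ} (hn : 0 < n) (hU : U (n - 1) = y (n - 1))
    (hL : L (n - 1) = y (n - 1)) : IsSuffixExtrema n (n - 1) y U L where
  le_max k j _ _ _ := by
    obtain rfl : k = n - 1 := by omega
    obtain rfl : j = n - 1 := by omega
    exact hU.ge
  min_le k j _ _ _ := by
    obtain rfl : k = n - 1 := by omega
    obtain rfl : j = n - 1 := by omega
    exact hL.le
  max_le k _ _ c hc := by
    obtain rfl : k = n - 1 := by omega
    exact hU.trans_le (hc _ le_rfl (by omega))
  le_min k _ _ c hc := by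
    obtain rfl : k = n - 1 := by omega
    exact (hc _ le_rfl (by omega)).trans hL.ge

theorem pred {n m : ℕ} {y U L : ℕ → ℝ} (h : IsSuffixExtrema n (m + 1) y U L) (hm : m + 1 < n) :
    IsSuffixExtrema n m y (Function.update U m (max (U (m + 1)) (y m)))
      (Function.update L m (min (L (m + 1)) (y m))) where
  le_max k j hk hkj hj := by
    rcases hk.lt_or_eq with hk | rfl
    · rw [Function.update_of_ne (by omega)]
      exact h.le_max k j hk hkj hj
    · rw [Function.update_self]
      rcases hkj.lt_or_eq with hkj | rfl
      · exact (h.le_max _ j le_rfl hkj hj).trans (le_max_left _ _)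
      · exact le_max_right _ _
  min_le k j hk hkj hj := by
    rcases hk.lt_or_eq with hk | rfl
    · rw [Function.update_of_ne (by omega)]
      exact h.min_le k j hk hkj hj
    · rw [Function.update_self]
      rcases hkj.lt_or_eq with hkj | rfl
      · exact (min_le_left _ _).trans (h.min_le _ j le_rfl hkj hj)
      · exact min_le_right _ _
  max_le k hk hkn c hc := by
    rcases hk.lt_or_eq with hk | rfl
    · rw [Function.update_of_ne (by omega)]
      exact h.max_le k hk hkn c hc
    · rw [Function.update_self]
      exact _root_.max_le (h.max_le _ le_rfl hm c fun j hj => hc j (by omega)) (hc m le_rfl hkn)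
  le_min k hk hkn c hc := by
    rcases hk.lt_or_eq with hk | rfl
    · rw [Function.update_of_ne (by omega)]
      exact h.le_min k hk hkn c hc
    · rw [Function.update_self]
      exact _root_.le_min (h.le_min _ le_rfl hm c fun j hj => hc j (by omega)) (hc m le_rfl hkn)

end IsSuffixExtrema

/-- The maximum of the ordinates of the points before `i` and after `j`. -/
noncomputable def topAround (n : ℕ) (A : ℕ → ℝ × ℝ) (U L : ℕ → ℝ) (i j : ℕ) : ℝ :=
  max (prefixMax (L 0) (fun k => (A k).2) i) (if j + 1 < n then U (j + 1) else L 0)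

/-- The minimum of the ordinates of the points before `i` and after `j`. -/
noncomputable def botAround (n : ℕ) (A : ℕ → ℝ × ℝ) (U L : ℕ → ℝ) (i j : ℕ) : ℝ :=
  min (prefixMin (U 0) (fun k => (A k).2) i) (if j + 1 < n then L (j + 1) else U 0)

/-- The extrema of an empty set of ordinates are replaced by `L 0 ≤ U 0`, the overall minimum (for
the maximum) and maximum (for the minimum). -/
theorem IsSuffixExtrema.isEnvelope {n : ℕ} {A : ℕ → ℝ × ℝ} {U L : ℕ → ℝ} (hn : 0 < n)
    (h : IsSuffixExtrema n 0 (fun k => (A k).2) U L) :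
    IsEnvelope n A (topAround n A U L) (botAround n A U L) where
  le_top i j k hk hkij := by
    rcases hkij with hki | hjk
    · exact (le_prefixMax _ (fun k => (A k).2) hki).trans (le_max_left _ _)
    · rw [topAround, if_pos (by omega)]
      exact (h.le_max (j + 1) k (Nat.zero_le _) hjk hk).trans (le_max_right _ _)
  bot_le i j k hk hkij := by
    rcases hkij with hki | hjk
    · exact (min_le_left _ _).trans (prefixMin_le _ (fun k => (A k).2) hki)
    · rw [botAround, if_pos (by omega)]
      exact (min_le_right _ _).trans (h.min_le (j + 1) k (Nat.zero_le _) hjk hk)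
  tight i j hi hj c r hr hkij := by
    -- If some point lies outside the window, the default values are harmless: `L 0` is at most its
    -- ordinate and `U 0` at least.
    by_cases hout : ∃ k < n, k < i ∨ j < k
    · obtain ⟨k, hk, hkout⟩ := hout
      have hb := fun k hk hkout => abs_le.1 (hkij k hk hkout)
      have hU : L 0 ≤ c + r / 2 := (h.min_le 0 k le_rfl (Nat.zero_le _) hk).trans
        (by linarith [(hb k hk hkout).2])
      have hL : c - r / 2 ≤ U 0 := le_trans (by linarith [(hb k hk hkout).1])
        (h.le_max 0 k le_rfl (Nat.zero_le _) hk)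
      have h1 : topAround n A U L i j ≤ c + r / 2 := by
        refine _root_.max_le (prefixMax_le hU fun k hk => ?_) ?_
        · linarith [(hb k (by omega) (Or.inl hk)).2]
        · split_ifs with hjn
          · exact h.max_le _ (Nat.zero_le _) hjn _ fun k h1 h2 => by linarith [(hb k h2 (Or.inr h1)).2]
          · exact hU
      have h2 : c - r / 2 ≤ botAround n A U L i j := by
        refine _root_.le_min (le_prefixMin hL fun k hk => ?_) ?_
        · linarith [(hb k (by omega) (Or.inl hk)).1]
        · split_ifs with hjn
          · exact h.le_min _ (Nat.zero_le _) hjn _ fun k h1 h2 => by linarith [(hb k h2 (Or.inr h1)).1]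
          · exact hL
      linarith
    -- No outside point means `i = 0` and `j + 1 = n`. Only the defaults remain, and their
    -- difference `L 0 - U 0` is at most `0`.
    · push Not at hout
      obtain rfl : i = 0 := by
        by_contra hi0
        have := (hout 0 hn).1
        omega
      have hjn : ¬ j + 1 < n := fun hjn => by
        have := (hout (j + 1) hjn).2
        omega
      have h0 : L 0 ≤ U 0 := (h.min_le 0 0 le_rfl le_rfl hn).trans (h.le_max 0 0 le_rfl le_rfl hn)
      simp only [topAround, botAround, prefixMax, prefixMin, if_neg hjn, max_self, min_self]
      linarith
  mono i i' j hi _ _ := by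
    have h1 := prefixMax_mono (L 0) (fun k => (A k).2) hi
    have h2 := prefixMin_anti (U 0) (fun k => (A k).2) hi
    exact sub_le_sub (max_le_max h1 le_rfl) (min_le_min h2 le_rfl)

/-! ## Merging -/

/-- A merge of the sorted `A lo, …, A (mid - 1)` and `A mid, …, A (hi - 1)` into `B`, in which the
entries before `i` and before `j`, respectively, have been moved to `B lo, …, B (k - 1)`. -/
structure MergeInv (A B : ℕ → ℝ × ℝ) (lo mid hi i j k : ℕ) : Prop where
  lo_le : lo ≤ i
  i_le : i ≤ mid
  mid_le : mid ≤ j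
  j_le : j ≤ hi
  k_eq : k + mid = i + j
  sorted : SortedOn B lo k
  below : ∀ k', lo ≤ k' → k' < k → ∀ i', i ≤ i' ∧ i' < mid ∨ j ≤ i' ∧ i' < hi →
    (B k').1 ≤ (A i').1
  image : B '' Set.Ico lo k = A '' (Set.Ico lo i ∪ Set.Ico mid j)

section Merge

variable {A B : ℕ → ℝ × ℝ} {lo mid hi i j k : ℕ}

theorem SortedOn.update {z : ℝ × ℝ} (h : SortedOn B lo k)
    (hz : ∀ k', lo ≤ k' → k' < k → (B k').1 ≤ z.1) :
    SortedOn (Function.update B k z) lo (k + 1) := by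
  intro i j hi hij hj
  rcases Nat.lt_or_ge j k with hjk | hjk
  · rw [Function.update_of_ne (by omega), Function.update_of_ne (by omega)]
    exact h i j hi hij hjk
  · obtain rfl : j = k := by omega
    rw [Function.update_self]
    rcases hij.lt_or_eq with hlt | rfl
    · rw [Function.update_of_ne (by omega)]
      exact hz i hi hlt
    · rw [Function.update_self]

theorem image_update_Ico_succ (B : ℕ → ℝ × ℝ) (z : ℝ × ℝ) (hk : lo ≤ k) :
    Function.update B k z '' Set.Ico lo (k + 1) = insert z (B '' Set.Ico lo k) := by
  have : Set.Ico lo (k + 1) = insert k (Set.Ico lo k) := by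
    ext x; simp only [Set.mem_Ico, Set.mem_insert_iff]; omega
  rw [this, Set.image_insert_eq, Function.update_self]
  congr 1
  refine Set.image_congr fun x hx => Function.update_of_ne hx.2.ne _ _

namespace MergeInv

theorem init (A B : ℕ → ℝ × ℝ) (hlo : lo ≤ mid) (hmid : mid ≤ hi) :
    MergeInv A B lo mid hi lo mid lo where
  lo_le := le_rfl
  i_le := hlo
  mid_le := le_rfl
  j_le := hmid
  k_eq := rfl
  sorted := fun i j _ _ _ => by omega
  below := fun k' _ _ => by omega
  image := by simp

theorem take_left (h : MergeInv A B lo mid hi i j k) (hA : SortedOn A lo mid)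
    (hA' : SortedOn A mid hi) (him : i < mid) (hij : j < hi → (A i).1 ≤ (A j).1) :
    MergeInv A (Function.update B k (A i)) lo mid hi (i + 1) j (k + 1) where
  lo_le := h.lo_le.trans (Nat.le_succ _)
  i_le := him
  mid_le := h.mid_le
  j_le := h.j_le
  k_eq := by have := h.k_eq; omega
  sorted := h.sorted.update fun k' h1 h2 => h.below k' h1 h2 i (Or.inl ⟨le_rfl, him⟩)
  below k' h1 h2 i' hi' := by
    rcases Nat.lt_or_ge k' k with hk | hk
    · rw [Function.update_of_ne (by omega)]
      exact h.below k' h1 hk i' (by omega)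
    · obtain rfl : k' = k := by omega
      rw [Function.update_self]
      rcases hi' with hi' | hi'
      · exact hA _ _ h.lo_le (by omega) hi'.2
      · exact (hij (by omega)).trans (hA' _ _ h.mid_le hi'.1 hi'.2)
  image := by
    have hk : lo ≤ k := by have := h.k_eq; have := h.lo_le; have := h.mid_le; omega
    have : Set.Ico lo (i + 1) ∪ Set.Ico mid j = insert i (Set.Ico lo i ∪ Set.Ico mid j) := by
      ext x; have := h.lo_le; simp only [Set.mem_Ico, Set.mem_insert_iff, Set.mem_union]; omega
    rw [image_update_Ico_succ _ _ hk, h.image, this, Set.image_insert_eq]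

theorem take_right (h : MergeInv A B lo mid hi i j k) (hA : SortedOn A lo mid)
    (hA' : SortedOn A mid hi) (hj : j < hi) (hij : i < mid → (A j).1 ≤ (A i).1) :
    MergeInv A (Function.update B k (A j)) lo mid hi i (j + 1) (k + 1) where
  lo_le := h.lo_le
  i_le := h.i_le
  mid_le := h.mid_le.trans (Nat.le_succ _)
  j_le := hj
  k_eq := by have := h.k_eq; omega
  sorted := h.sorted.update fun k' h1 h2 => h.below k' h1 h2 j (Or.inr ⟨le_rfl, hj⟩)
  below k' h1 h2 i' hi' := by
    rcases Nat.lt_or_ge k' k with hk | hk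
    · rw [Function.update_of_ne (by omega)]
      exact h.below k' h1 hk i' (by omega)
    · obtain rfl : k' = k := by omega
      rw [Function.update_self]
      rcases hi' with hi' | hi'
      · exact (hij (by omega)).trans (hA _ _ h.lo_le hi'.1 hi'.2)
      · exact hA' _ _ h.mid_le (by omega) hi'.2
  image := by
    have hk : lo ≤ k := by have := h.k_eq; have := h.lo_le; have := h.mid_le; omega
    have : Set.Ico lo i ∪ Set.Ico mid (j + 1) = insert j (Set.Ico lo i ∪ Set.Ico mid j) := by
      ext x; have := h.mid_le; simp only [Set.mem_Ico, Set.mem_insert_iff, Set.mem_union]; omega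
    rw [image_update_Ico_succ _ _ hk, h.image, this, Set.image_insert_eq]

/-- Only sets of points are compared, not multiplicities; this suffices because enclosing crosses
depend only on the set. -/
theorem image_eq (h : MergeInv A B lo mid hi i j k) (hk : hi ≤ k) :
    B '' Set.Ico lo hi = A '' Set.Ico lo hi := by
  have h1 := h.i_le; have h2 := h.j_le; have h3 := h.k_eq
  have h4 := h.lo_le; have h5 := h.mid_le
  obtain rfl : i = mid := by omega
  obtain rfl : j = hi := by omega
  obtain rfl : k = j := by omega
  rw [h.image, Set.Ico_union_Ico_eq_Ico h4 h5]

end MergeInv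

/-- The consecutive blocks of length `w` that start before `w * m` are sorted, up to position
`n`. -/
def BlocksSorted (B : ℕ → ℝ × ℝ) (w n m : ℕ) : Prop :=
  ∀ b < m, SortedOn B (w * b) (min (w * (b + 1)) n)

theorem SortedOn.congr {B' : ℕ → ℝ × ℝ} (h : SortedOn B lo hi)
    (hB : ∀ k, lo ≤ k → k < hi → B' k = B k) : SortedOn B' lo hi := by
  intro i j hi hij hj
  rw [hB i hi (by omega), hB j (by omega) hj]
  exact h i j hi hij hj

theorem BlocksSorted.succ {B' : ℕ → ℝ × ℝ} {w n m : ℕ} (h : BlocksSorted B w n m)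
    (hB : ∀ k < w * m, B' k = B k) (hm : SortedOn B' (w * m) (min (w * (m + 1)) n)) :
    BlocksSorted B' w n (m + 1) := by
  intro b hb
  rcases Nat.lt_or_ge b m with hbm | hbm
  · refine (h b hbm).congr fun k _ hk => hB k ?_
    have : w * (b + 1) ≤ w * m := Nat.mul_le_mul_left w hbm
    omega
  · obtain rfl : b = m := by omega
    exact hm

theorem image_Ico_append {B' : ℕ → ℝ × ℝ} (hlo : lo ≤ hi)
    (h : B '' Set.Ico 0 lo = A '' Set.Ico 0 lo) (hB : ∀ k < lo, B' k = B k)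
    (h' : B' '' Set.Ico lo hi = A '' Set.Ico lo hi) :
    B' '' Set.Ico 0 hi = A '' Set.Ico 0 hi := by
  rw [← Set.Ico_union_Ico_eq_Ico (Nat.zero_le lo) hlo, Set.image_union, Set.image_union, h', ← h,
    Set.image_congr fun k hk => hB k hk.2]

end Merge

/-! ## Running programs -/

namespace RealRAM

namespace Program

open Classical in
/-- The effect of a loop-free program. -/
noncomputable def exec : Program → State → State
  | skip, s => s
  | setNat i e, s => s.setNatReg i (e.eval s)
  | setReal i e, s => s.setRealReg i (e.eval s)
  | putNat a j e, s => s.setNatArr a (j.eval s) (e.eval s)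
  | putReal a j e, s => s.setRealArr a (j.eval s) (e.eval s)
  | seq P Q, s => Q.exec (P.exec s)
  | ifThenElse b P Q, s => if b.Holds s then P.exec s else Q.exec s
  | whileDo _ _, s => s

/-- A bound for the running time of a loop-free program. -/
def bound : Program → ℕ
  | skip => 1
  | setNat _ e => 1 + e.cost
  | setReal _ e => 1 + e.cost
  | putNat _ j e => 1 + j.cost + e.cost
  | putReal _ j e => 1 + j.cost + e.cost
  | seq P Q => P.bound + Q.bound
  | ifThenElse b P Q => 1 + b.cost + max P.bound Q.bound
  | whileDo _ _ => 0

/-- The program is loop-free and keeps to words of size `W`. -/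
def Safe (W : ℕ) : Program → State → Prop
  | skip, _ => True
  | setNat _ e, s => e.eval s ≤ W
  | setReal _ _, _ => True
  | putNat _ j e, s => j.eval s ≤ W ∧ e.eval s ≤ W
  | putReal _ j _, s => j.eval s ≤ W
  | seq P Q, s => P.Safe W s ∧ Q.Safe W (P.exec s)
  | ifThenElse b P Q, s => (b.Holds s → P.Safe W s) ∧ (¬ b.Holds s → Q.Safe W s)
  | whileDo _ _, _ => False

/-- Reduces loop-free code to three computations: `simp` evaluates `exec` and `Safe`, and `decide`
evaluates `bound`. -/
theorem runs_exec {W : ℕ} (P : Program) {s : State} (h : P.Safe W s) :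
    ∃ t ≤ P.bound, Runs W P s t (P.exec s) := by
  induction P generalizing s with
  | skip => exact ⟨_, le_rfl, .skip s⟩
  | setNat i e => exact ⟨_, le_rfl, .setNat i e s h⟩
  | setReal i e => exact ⟨_, le_rfl, .setReal i e s⟩
  | putNat a j e => exact ⟨_, le_rfl, .putNat a j e s h.1 h.2⟩
  | putReal a j e => exact ⟨_, le_rfl, .putReal a j e s h⟩
  | seq P Q ihP ihQ =>
    obtain ⟨t, ht, hP⟩ := ihP h.1
    obtain ⟨t', ht', hQ⟩ := ihQ h.2
    exact ⟨_, add_le_add ht ht', .seq P Q _ _ _ _ _ hP hQ⟩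
  | ifThenElse b P Q ihP ihQ =>
    by_cases hb : b.Holds s
    · obtain ⟨t, ht, hP⟩ := ihP (h.1 hb)
      rw [exec, if_pos hb]
      exact ⟨_, Nat.add_le_add_left (ht.trans (le_max_left _ _)) _, .ifTrue b P Q _ _ _ hb hP⟩
    · obtain ⟨t, ht, hQ⟩ := ihQ (h.2 hb)
      rw [exec, if_neg hb]
      exact ⟨_, Nat.add_le_add_left (ht.trans (le_max_right _ _)) _, .ifFalse b P Q _ _ _ hb hQ⟩
  | whileDo b P => exact h.elim

end Program

/-- A loop with invariant `I`, whose iterations are paid for by a decrease of the potential `μ`. -/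
theorem runs_whileDo {W : ℕ} {b : Test} {P : Program} (I : State → Prop) (μ : State → ℕ)
    (hstep : ∀ s, I s → b.Holds s →
      ∃ t s', Runs W P s t s' ∧ I s' ∧ 1 + b.cost + t + μ s' ≤ μ s)
    {s : State} (hs : I s) :
    ∃ t s', Runs W (.whileDo b P) s t s' ∧ I s' ∧ ¬ b.Holds s' ∧ t ≤ μ s + (1 + b.cost) := by
  -- Each iteration costs at least `1`, so the potential strictly decreases; the extra `1 + b.cost`
  -- pays for the final failing test.
  induction hm : μ s using Nat.strong_induction_on generalizing s with
  | _ m ih =>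
    by_cases hb : b.Holds s
    · obtain ⟨t, s', hr, hI, hμ⟩ := hstep s hs hb
      obtain ⟨t', s'', hr', hI', hb', ht'⟩ := ih (μ s') (by omega) hI rfl
      exact ⟨_, s'', .whileTrue b P s s' s'' t t' hb hr hr', hI', hb', by omega⟩
    · exact ⟨_, s, .whileFalse b P s hb, hs, hb, by omega⟩

/-- The assignment of a maximum to a register. -/
def setMax (i : ℕ) (e f : RealExpr) : Program :=
  .ifThenElse (.realLE e f) (.setReal i f) (.setReal i e)

/-- The assignment of a minimum to a register. -/
def setMin (i : ℕ) (e f : RealExpr) : Program :=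
  .ifThenElse (.realLE e f) (.setReal i e) (.setReal i f)

@[simp] theorem exec_setMax (i : ℕ) (e f : RealExpr) (s : State) :
    (setMax i e f).exec s = s.setRealReg i (max (e.eval s) (f.eval s)) := by
  by_cases h : (Test.realLE e f).Holds s
  · rw [setMax, Program.exec, if_pos h, Program.exec, max_eq_right h]
  · rw [setMax, Program.exec, if_neg h, Program.exec, max_eq_left (not_le.1 h).le]

@[simp] theorem exec_setMin (i : ℕ) (e f : RealExpr) (s : State) :
    (setMin i e f).exec s = s.setRealReg i (min (e.eval s) (f.eval s)) := by
  by_cases h : (Test.realLE e f).Holds s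
  · rw [setMin, Program.exec, if_pos h, Program.exec, min_eq_left h]
  · rw [setMin, Program.exec, if_neg h, Program.exec, min_eq_right (not_le.1 h).le]

@[simp] theorem safe_setMax (W i : ℕ) (e f : RealExpr) (s : State) :
    (setMax i e f).Safe W s := by simp [setMax, Program.Safe]

@[simp] theorem safe_setMin (W i : ℕ) (e f : RealExpr) (s : State) :
    (setMin i e f).Safe W s := by simp [setMin, Program.Safe]

attribute [simp] Program.exec Program.Safe NatExpr.eval RealExpr.eval Test.Holds
  State.setNatReg State.setRealReg State.setNatArr State.setRealArr

end RealRAM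

/-! ## Merge sort on the real RAM -/

namespace RealRAM

/-- The points in the real arrays `0` and `1`. -/
def State.source (s : State) (k : ℕ) : ℝ × ℝ := (s.realArr 0 k, s.realArr 1 k)

/-- The points in the real arrays `2` and `3`. -/
def State.buffer (s : State) (k : ℕ) : ℝ × ℝ := (s.realArr 2 k, s.realArr 3 k)

theorem pair_update (f g : ℕ → ℝ) (k : ℕ) (a b : ℝ) :
    (fun j => (Function.update f k a j, Function.update g k b j)) =
      Function.update (fun j => (f j, g j)) k (a, b) := by
  funext j
  by_cases h : j = k
  · subst h; simp
  · simp [h]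

/-- Moves the source point whose index is in register `r` to the buffer and advances. -/
def moveToBuffer (r : ℕ) : Program :=
  .seq (.putReal 2 (.reg 7) (.get 0 (.reg r)))
  (.seq (.putReal 3 (.reg 7) (.get 1 (.reg r)))
  (.seq (.setNat r (.add (.reg r) (.const 1)))
    (.setNat 7 (.add (.reg 7) (.const 1)))))

def lessThan (e f : NatExpr) : Test := .natLE (.add e (.const 1)) f

@[simp] theorem holds_lessThan (e f : NatExpr) (s : State) :
    (lessThan e f).Holds s ↔ e.eval s < f.eval s := Iff.rfl

/-- One step of the merge of the source ranges from register `5` to `3` and from `6` to `4`. -/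
def mergeStep : Program :=
  .ifThenElse
    (.conj (lessThan (.reg 5) (.reg 3))
      (.neg (.conj (lessThan (.reg 6) (.reg 4))
        (.neg (.realLE (.get 0 (.reg 5)) (.get 0 (.reg 6)))))))
    (moveToBuffer 5) (moveToBuffer 6)

def mergeLoop : Program := .whileDo (lessThan (.reg 7) (.reg 4)) mergeStep

theorem runs_mergeLoop {W lo : ℕ} {s : State} (hlo : lo ≤ s.natReg 3)
    (hmid : s.natReg 3 ≤ s.natReg 4) (hW : s.natReg 4 ≤ W) (h5 : s.natReg 5 = lo)
    (h6 : s.natReg 6 = s.natReg 3) (h7 : s.natReg 7 = lo)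
    (hA : SortedOn s.source lo (s.natReg 3))
    (hA' : SortedOn s.source (s.natReg 3) (s.natReg 4)) :
    ∃ t s', Runs W mergeLoop s t s' ∧ t ≤ 60 * (s.natReg 4 - lo) + 6 ∧
      (∀ r < 5, s'.natReg r = s.natReg r) ∧ s'.source = s.source ∧
      (∀ k < lo, s'.buffer k = s.buffer k) ∧ SortedOn s'.buffer lo (s.natReg 4) ∧
      s'.buffer '' Set.Ico lo (s.natReg 4) = s.source '' Set.Ico lo (s.natReg 4) := by
  obtain ⟨t, s', hr, ⟨hreg, hsrc, hbuf, hI⟩, hb, ht⟩ := runs_whileDo (W := W)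
    (b := lessThan (.reg 7) (.reg 4)) (P := mergeStep)
    (fun s' => (∀ r < 5, s'.natReg r = s.natReg r) ∧ s'.source = s.source ∧
      (∀ k < lo, s'.buffer k = s.buffer k) ∧
      MergeInv s.source s'.buffer lo (s.natReg 3) (s.natReg 4) (s'.natReg 5) (s'.natReg 6)
        (s'.natReg 7))
    (fun s' => 60 * (s.natReg 4 - s'.natReg 7))
    (by
      rintro s' ⟨hreg, hsrc, hbuf, hI⟩ hb
      have h3 := hreg 3 (by omega)
      have h4 := hreg 4 (by omega)
      simp only [holds_lessThan, NatExpr.eval, h4] at hb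
      have hk := hI.k_eq
      have e1 := hI.i_le
      have e2 := hI.j_le
      have e3 := hI.lo_le
      have e4 := hI.mid_le
      have hxi : ∀ i, s'.realArr 0 i = (s.source i).1 :=
        fun i => congrArg Prod.fst (congrFun hsrc i)
      have hpi : ∀ i, (s'.realArr 0 i, s'.realArr 1 i) = s.source i := fun i => congrFun hsrc i
      have hcost : ∀ t ≤ mergeStep.bound, ∀ k, k = s'.natReg 7 + 1 →
          1 + (lessThan (.reg 7) (.reg 4)).cost + t + 60 * (s.natReg 4 - k) ≤
            60 * (s.natReg 4 - s'.natReg 7) := by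
        intro t ht k hk
        -- One iteration costs at most `1 + 5 + 50`, within the `60` released when register `7`
        -- advances.
        have : mergeStep.bound ≤ 50 := by decide
        have : (lessThan (.reg 7) (.reg 4)).cost = 5 := by decide
        omega
      have hsafe : mergeStep.Safe W s' := by
        simp [mergeStep, moveToBuffer]
        omega
      obtain ⟨t, ht, hr⟩ := mergeStep.runs_exec hsafe
      refine ⟨t, _, hr, ?_⟩
      -- The second conjunct is an implication; as tests have no disjunction, `mergeStep` spells it
      -- with two negations. An exhausted right range thus sends the left point.
      by_cases htest : s'.natReg 5 < s.natReg 3 ∧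
          (s'.natReg 6 < s.natReg 4 → (s.source (s'.natReg 5)).1 ≤ (s.source (s'.natReg 6)).1)
      · have hx : mergeStep.exec s' = (moveToBuffer 5).exec s' := by
          rw [mergeStep, Program.exec, if_pos]
          simpa [h3, h4, hxi] using htest
        rw [hx]
        refine ⟨⟨?_, ?_, ?_, ?_⟩, ?_⟩
        · intro r hr
          simp [moveToBuffer, hr.ne, show r ≠ 7 by omega, hreg r hr]
        · rw [← hsrc]
          funext i
          simp [moveToBuffer, State.source]
        · intro k hk
          rw [← hbuf k hk]
          simp [moveToBuffer, State.buffer, show k ≠ s'.natReg 7 by omega]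
        · have := hI.take_left hA hA' htest.1 htest.2
          rw [← hpi] at this
          unfold State.buffer at this ⊢
          rw [← pair_update] at this
          simpa [moveToBuffer] using this
        · refine hcost t ht _ ?_
          simp [moveToBuffer]
      · have hx : mergeStep.exec s' = (moveToBuffer 6).exec s' := by
          rw [mergeStep, Program.exec, if_neg]
          simpa [h3, h4, hxi] using htest
        rw [hx]
        refine ⟨⟨?_, ?_, ?_, ?_⟩, ?_⟩
        · intro r hr
          simp [moveToBuffer, show r ≠ 6 by omega, show r ≠ 7 by omega, hreg r hr]
        · rw [← hsrc]
          funext i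
          simp [moveToBuffer, State.source]
        · intro k hk
          rw [← hbuf k hk]
          simp [moveToBuffer, State.buffer, show k ≠ s'.natReg 7 by omega]
        · have := hI.take_right hA hA' (by
            by_contra hj
            exact htest ⟨by omega, fun h => absurd h hj⟩) (fun hi => by
            by_contra hlt
            exact htest ⟨hi, fun _ => (not_le.1 hlt).le⟩)
          rw [← hpi] at this
          unfold State.buffer at this ⊢
          rw [← pair_update] at this
          simpa [moveToBuffer] using this
        · refine hcost t ht _ ?_
          simp [moveToBuffer])
    (s := s)
    ⟨fun _ _ => rfl, rfl, fun _ _ => rfl, by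
      rw [h5, h6, h7]; exact MergeInv.init _ _ hlo hmid⟩
  have hk : s.natReg 4 ≤ s'.natReg 7 := by
    simpa [hreg 4 (by omega)] using hb
  have hk' : s'.natReg 7 = s.natReg 4 := by
    have := hI.k_eq; have := hI.i_le; have := hI.j_le; omega
  refine ⟨t, s', hr, ?_, hreg, hsrc, hbuf, hk' ▸ hI.sorted, hI.image_eq hk⟩
  rw [h7] at ht
  exact ht

end RealRAM

namespace RealRAM

/-- Sets up the merge of the two blocks of length `w` (register `1`) from register `2` on. -/
def blockInit : Program :=
  .seq (.setNat 3 (.sub (.add (.reg 2) (.reg 1)) (.sub (.add (.reg 2) (.reg 1)) (.reg 0))))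
  (.seq (.setNat 4 (.sub (.add (.reg 2) (.add (.reg 1) (.reg 1)))
    (.sub (.add (.reg 2) (.add (.reg 1) (.reg 1))) (.reg 0))))
  (.seq (.setNat 5 (.reg 2))
  (.seq (.setNat 6 (.reg 3))
    (.setNat 7 (.reg 2)))))

def blockNext : Program := .setNat 2 (.add (.reg 2) (.add (.reg 1) (.reg 1)))

def blockStep : Program := .seq blockInit (.seq mergeLoop blockNext)

theorem runs_blockStep {W n w lo : ℕ} {s : State} (hW : 4 * n ≤ W) (hn : s.natReg 0 = n)
    (hw : s.natReg 1 = w) (hlo : s.natReg 2 = lo) (hlon : lo < n) (hwn : w < n)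
    (hA : SortedOn s.source lo (min (lo + w) n))
    (hA' : SortedOn s.source (lo + w) (min (lo + 2 * w) n)) :
    ∃ t s', Runs W blockStep s t s' ∧ t ≤ 60 * (min (lo + 2 * w) n - lo) + 60 ∧
      (∀ r < 2, s'.natReg r = s.natReg r) ∧ s'.natReg 2 = lo + 2 * w ∧ s'.source = s.source ∧
      (∀ k < lo, s'.buffer k = s.buffer k) ∧ SortedOn s'.buffer lo (min (lo + 2 * w) n) ∧
      s'.buffer '' Set.Ico lo (min (lo + 2 * w) n) =
        s.source '' Set.Ico lo (min (lo + 2 * w) n) := by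
  have hsafe : blockInit.Safe W s := by
    simp [blockInit, hn, hw, hlo]
    omega
  obtain ⟨t₁, ht₁, hr₁⟩ := blockInit.runs_exec hsafe
  set s₁ := blockInit.exec s with hs₁
  have h1 : s₁.natReg 1 = w := by simp [hs₁, blockInit, hw]
  have h2 : s₁.natReg 2 = lo := by simp [hs₁, blockInit, hlo]
  -- With truncated subtraction, `x - (x - n)` is `min x n`.
  have h3 : s₁.natReg 3 = min (lo + w) n := by simp [hs₁, blockInit, hn, hw, hlo]; omega
  have h4 : s₁.natReg 4 = min (lo + 2 * w) n := by simp [hs₁, blockInit, hn, hw, hlo]; omega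
  have hsrc₁ : s₁.source = s.source := by funext k; simp [hs₁, blockInit, State.source]
  have hbuf₁ : s₁.buffer = s.buffer := by funext k; simp [hs₁, blockInit, State.buffer]
  have hreg₁ : ∀ r < 2, s₁.natReg r = s.natReg r := fun r hr => by
    simp [hs₁, blockInit, show r ≠ 3 by omega, show r ≠ 4 by omega, show r ≠ 5 by omega,
      show r ≠ 6 by omega, show r ≠ 7 by omega]
  obtain ⟨t₂, s₂, hr₂, ht₂, hreg₂, hsrc₂, hbuf₂, hsort, himg⟩ :=
    runs_mergeLoop (W := W) (lo := lo) (s := s₁) (by omega) (by omega) (by omega)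
      (by simp [hs₁, blockInit, hlo])
      (by simp [hs₁, blockInit]) (by simp [hs₁, blockInit, hlo])
      (by rw [hsrc₁, h3]; exact hA)
      -- If `lo + w ≥ n`, the second block is empty; otherwise the minimum is `lo + w`.
      (by
        rw [hsrc₁, h3, h4]
        intro i j hi hij hj
        exact hA' i j (by omega) hij hj)
  rw [h4, hsrc₁] at himg
  rw [h4] at hsort ht₂
  have hsafe₂ : blockNext.Safe W s₂ := by
    simp [blockNext, hreg₂, h1, h2]
    omega
  obtain ⟨t₃, ht₃, hr₃⟩ := blockNext.runs_exec hsafe₂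
  refine ⟨_, _, .seq _ _ _ _ _ _ _ hr₁ (.seq _ _ _ _ _ _ _ hr₂ hr₃), ?_, ?_, ?_, ?_, ?_, ?_, ?_⟩
  · have : blockInit.bound ≤ 40 := by decide
    have : blockNext.bound ≤ 10 := by decide
    omega
  · intro r hr
    rw [← hreg₁ r hr, ← hreg₂ r (by omega)]
    simp [blockNext, hr.ne]
  · simp [blockNext, hreg₂, h1, h2]
    omega
  · rw [← hsrc₁, ← hsrc₂]
    funext k
    simp [blockNext, State.source]
  · intro k hk
    rw [← hbuf₁, ← hbuf₂ k hk]
    simp [blockNext, State.buffer]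
  · exact hsort.congr fun k _ _ => by simp [blockNext, State.buffer]
  · rw [← himg]
    exact Set.image_congr fun k _ => by simp [blockNext, State.buffer]

def passLoop : Program := .whileDo (lessThan (.reg 2) (.reg 0)) blockStep

theorem runs_passLoop {W n w : ℕ} {s : State} (hW : 4 * n ≤ W) (hn : s.natReg 0 = n)
    (hw : s.natReg 1 = w) (hlo : s.natReg 2 = 0) (hwn : w < n) (hw0 : 0 < w)
    (hA : ∀ m, BlocksSorted s.source w n m) :
    ∃ t s', Runs W passLoop s t s' ∧ t ≤ 160 * n + 6 ∧ (∀ r < 2, s'.natReg r = s.natReg r) ∧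
      (∀ m, BlocksSorted s'.buffer (2 * w) n m) ∧
      s'.buffer '' Set.Ico 0 n = s.source '' Set.Ico 0 n := by
  obtain ⟨t, s', hr, ⟨hreg, -, m, hm, hsort, himg⟩, hb, ht⟩ := runs_whileDo (W := W)
    (b := lessThan (.reg 2) (.reg 0)) (P := blockStep)
    (fun s' => (∀ r < 2, s'.natReg r = s.natReg r) ∧ s'.source = s.source ∧
      ∃ m, s'.natReg 2 = 2 * w * m ∧ BlocksSorted s'.buffer (2 * w) n m ∧
        s'.buffer '' Set.Ico 0 (min (2 * w * m) n) = s.source '' Set.Ico 0 (min (2 * w * m) n))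
    -- Every pair of blocks contains at least one point, so the constant overhead of a block step is
    -- charged to points.
    (fun s' => 160 * (n - s'.natReg 2))
    (by
      rintro s' ⟨hreg, hsrc, m, hm, hsort, himg⟩ hb
      have h0 : s'.natReg 0 = n := (hreg 0 (by omega)).trans hn
      have h1 : s'.natReg 1 = w := (hreg 1 (by omega)).trans hw
      simp only [holds_lessThan, NatExpr.eval, h0, hm] at hb
      have e1 : w * (2 * m) = 2 * w * m := by ring
      have e2 : w * (2 * m + 1) = 2 * w * m + w := by ring
      have e3 : w * (2 * m + 1 + 1) = 2 * w * m + 2 * w := by ring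
      have e4 : 2 * w * (m + 1) = 2 * w * m + 2 * w := by ring
      obtain ⟨t, s'', hr, ht, hreg', h2', hsrc', hbuf', hsort', himg'⟩ :=
        runs_blockStep hW h0 h1 hm hb hwn
          (by
            have := hA (2 * m + 1) (2 * m) (by omega)
            rwa [e1, e2, ← hsrc] at this)
          (by
            have := hA (2 * m + 2) (2 * m + 1) (by omega)
            rwa [e2, e3, ← hsrc] at this)
      refine ⟨t, s'', hr, ⟨fun r hr => (hreg' r hr).trans (hreg r hr), hsrc'.trans hsrc, m + 1,
        by rw [h2', e4], hsort.succ hbuf' (by rw [e4]; exact hsort'), ?_⟩, ?_⟩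
      · rw [e4]
        rw [min_eq_left hb.le] at himg
        exact image_Ico_append (by omega) himg hbuf' (by rw [himg', hsrc])
      · rw [h2', hm]
        have : (lessThan (.reg 2) (.reg 0)).cost = 5 := by decide
        omega)
    (s := s)
    ⟨fun _ _ => rfl, rfl, 0, by simpa using hlo, fun b hb => by omega, by simp⟩
  have hnm : n ≤ 2 * w * m := by
    simpa [hreg 0 (by omega), hn, hm] using hb
  refine ⟨t, s', hr, ?_, hreg, fun m' b _ => ?_, ?_⟩
  · rw [hlo] at ht
    exact ht
  -- Blocks from the `m`-th on start at or beyond `n` and are vacuously sorted.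
  · rcases Nat.lt_or_ge b m with hbm | hbm
    · exact hsort b hbm
    · intro i j hi hij hj
      have : 2 * w * m ≤ 2 * w * b := Nat.mul_le_mul_left _ hbm
      omega
  · rwa [min_eq_right hnm] at himg

def copyStep : Program :=
  .seq (.putReal 0 (.reg 7) (.get 2 (.reg 7)))
  (.seq (.putReal 1 (.reg 7) (.get 3 (.reg 7)))
    (.setNat 7 (.add (.reg 7) (.const 1))))

def copyLoop : Program := .whileDo (lessThan (.reg 7) (.reg 0)) copyStep

theorem runs_copyLoop {W n : ℕ} {s : State} (hW : n ≤ W) (hn : s.natReg 0 = n)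
    (hk : s.natReg 7 = 0) :
    ∃ t s', Runs W copyLoop s t s' ∧ t ≤ 60 * n + 6 ∧ (∀ r < 2, s'.natReg r = s.natReg r) ∧
      (∀ k < n, s'.source k = s.buffer k) := by
  obtain ⟨t, s', hr, ⟨hreg, -, hsrc⟩, hb, ht⟩ := runs_whileDo (W := W)
    (b := lessThan (.reg 7) (.reg 0)) (P := copyStep)
    (fun s' => (∀ r < 2, s'.natReg r = s.natReg r) ∧ s'.buffer = s.buffer ∧
      ∀ k < s'.natReg 7, s'.source k = s.buffer k)
    (fun s' => 60 * (n - s'.natReg 7))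
    (by
      rintro s' ⟨hreg, hbuf, hsrc⟩ hb
      have h0 : s'.natReg 0 = n := (hreg 0 (by omega)).trans hn
      simp only [holds_lessThan, NatExpr.eval, h0] at hb
      have hsafe : copyStep.Safe W s' := by
        simp [copyStep]
        omega
      obtain ⟨t, ht, hr⟩ := copyStep.runs_exec hsafe
      refine ⟨t, _, hr, ⟨fun r hr => ?_, ?_, fun k hk => ?_⟩, ?_⟩
      · rw [← hreg r hr]
        simp [copyStep, show r ≠ 7 by omega]
      · rw [← hbuf]
        funext k
        simp [copyStep, State.buffer]
      · by_cases hk' : k = s'.natReg 7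
        · subst hk'
          rw [← hbuf]
          simp [copyStep, State.source, State.buffer]
        · simp [copyStep] at hk
          rw [← hsrc k (by omega)]
          simp [copyStep, State.source, hk']
      · have : copyStep.bound ≤ 50 := by decide
        have : (lessThan (.reg 7) (.reg 0)).cost = 5 := by decide
        simp [copyStep]
        omega)
    (s := s)
    ⟨fun _ _ => rfl, rfl, fun k hk' => by omega⟩
  refine ⟨t, s', hr, ?_, hreg, fun k hkn => hsrc k ?_⟩
  · rw [hk] at ht
    exact ht
  · simp [hreg, hn] at hb
    omega

def sortStep : Program :=
  .seq (.setNat 2 (.const 0))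
  (.seq passLoop
  (.seq (.setNat 7 (.const 0))
  (.seq copyLoop
    (.setNat 1 (.add (.reg 1) (.reg 1))))))

theorem runs_sortStep {W n w : ℕ} {s : State} (hW : 4 * n ≤ W) (hn : s.natReg 0 = n)
    (hw : s.natReg 1 = w) (hwn : w < n) (hw0 : 0 < w)
    (hA : ∀ m, BlocksSorted s.source w n m) :
    ∃ t s', Runs W sortStep s t s' ∧ t ≤ 260 * n ∧ s'.natReg 0 = n ∧ s'.natReg 1 = 2 * w ∧
      (∀ m, BlocksSorted s'.source (2 * w) n m) ∧
      s'.source '' Set.Ico 0 n = s.source '' Set.Ico 0 n := by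
  obtain ⟨t₁, ht₁, hr₁⟩ := (Program.setNat 2 (.const 0)).runs_exec (W := W) (s := s) (by simp)
  set s₁ := (Program.setNat 2 (.const 0)).exec s with hs₁
  have hsrc₁ : s₁.source = s.source := rfl
  obtain ⟨t₂, s₂, hr₂, ht₂, hreg₂, hsort₂, himg₂⟩ := runs_passLoop (s := s₁) hW
    (by simp [hs₁, hn]) (by simp [hs₁, hw]) (by simp [hs₁]) hwn hw0 hA
  obtain ⟨t₃, ht₃, hr₃⟩ := (Program.setNat 7 (.const 0)).runs_exec (W := W) (s := s₂) (by simp)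
  set s₃ := (Program.setNat 7 (.const 0)).exec s₂ with hs₃
  obtain ⟨t₄, s₄, hr₄, ht₄, hreg₄, hsrc₄⟩ := runs_copyLoop (W := W) (n := n) (s := s₃) (by omega)
    (by simp [hs₃, hreg₂, hs₁, hn]) (by simp [hs₃])
  have h1 : s₄.natReg 1 = w := by simp [hreg₄, hs₃, hreg₂, hs₁, hw]
  obtain ⟨t₅, ht₅, hr₅⟩ := (Program.setNat 1 (.add (.reg 1) (.reg 1))).runs_exec (W := W)
    (s := s₄) (by simp [h1]; omega)
  refine ⟨_, _, .seq _ _ _ _ _ _ _ hr₁ (.seq _ _ _ _ _ _ _ hr₂ (.seq _ _ _ _ _ _ _ hr₃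
    (.seq _ _ _ _ _ _ _ hr₄ hr₅))), ?_, ?_, ?_, ?_, ?_⟩
  · simp [Program.bound, NatExpr.cost] at ht₁ ht₃ ht₅
    omega
  · simp [hreg₄, hs₃, hreg₂, hs₁, hn]
  · simp [h1]
    omega
  · exact fun m b hb => (hsort₂ m b hb).congr fun k _ hk => hsrc₄ k (by omega)
  · rw [← hsrc₁, ← himg₂]
    exact Set.image_congr fun k hk => hsrc₄ k hk.2

/-- Sorts the source points by abscissa. -/
def sort : Program :=
  .seq (.setNat 1 (.const 1)) (.whileDo (lessThan (.reg 1) (.reg 0)) sortStep)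

theorem runs_sort {W n : ℕ} {s : State} (hW : 4 * n ≤ W) (hn : s.natReg 0 = n) (hn0 : 0 < n) :
    ∃ t s', Runs W sort s t s' ∧ t ≤ 300 * n * Nat.clog 2 n + 8 ∧ s'.natReg 0 = n ∧
      SortedOn s'.source 0 n ∧ s'.source '' Set.Ico 0 n = s.source '' Set.Ico 0 n := by
  obtain ⟨t₁, ht₁, hr₁⟩ := (Program.setNat 1 (.const 1)).runs_exec (W := W) (s := s)
    (by simp; omega)
  set s₁ := (Program.setNat 1 (.const 1)).exec s with hs₁
  obtain ⟨t, s', hr, ⟨h0, r, h1, -, hsort, himg⟩, hb, ht⟩ := runs_whileDo (W := W)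
    (b := lessThan (.reg 1) (.reg 0)) (P := sortStep)
    (fun s' => s'.natReg 0 = n ∧ ∃ r, s'.natReg 1 = 2 ^ r ∧ r ≤ Nat.clog 2 n ∧
      (∀ m, BlocksSorted s'.source (2 ^ r) n m) ∧
      s'.source '' Set.Ico 0 n = s.source '' Set.Ico 0 n)
    -- The block length is a power of two, so each doubling lowers the factor by one and releases
    -- `300 * n`, enough for one pass.
    (fun s' => 300 * n * (Nat.clog 2 n - Nat.log 2 (s'.natReg 1)))
    (by
      rintro s' ⟨h0, r, h1, -, hsort, himg⟩ hb
      simp only [holds_lessThan, NatExpr.eval, h0, h1] at hb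
      have hrn := (Nat.lt_clog_iff_pow_lt one_lt_two).2 hb
      obtain ⟨t, s'', hr, ht, h0', h1', hsort', himg'⟩ :=
        runs_sortStep hW h0 h1 hb (by positivity) hsort
      rw [← Nat.pow_succ'] at h1' hsort'
      refine ⟨t, s'', hr, ⟨h0', r + 1, h1', hrn, hsort', himg'.trans himg⟩, ?_⟩
      rw [h1, h1', Nat.log_pow one_lt_two, Nat.log_pow one_lt_two]
      have : (lessThan (.reg 1) (.reg 0)).cost = 5 := by decide
      obtain ⟨d, hd⟩ := Nat.exists_eq_add_of_lt hrn
      rw [hd, show r + d + 1 - (r + 1) = d by omega, show r + d + 1 - r = d + 1 by omega, mul_add]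
      omega)
    (s := s₁)
    ⟨by simp [hs₁, hn], 0, by simp [hs₁], Nat.zero_le _, fun m b _ i j hi hij hj => by
      obtain rfl : i = j := by omega
      exact le_rfl, rfl⟩
  simp only [holds_lessThan, NatExpr.eval, h0, h1, not_lt] at hb
  refine ⟨_, _, .seq _ _ _ _ _ _ _ hr₁ hr, ?_, h0, ?_, himg⟩
  · have h2 : Nat.log 2 (s₁.natReg 1) = 0 := by simp [hs₁]
    have : (lessThan (.reg 1) (.reg 0)).cost = 5 := by decide
    simp [Program.bound, NatExpr.cost] at ht₁
    rw [h2, Nat.sub_zero] at ht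
    omega
  · have := hsort 1 0 (by omega)
    rwa [mul_zero, zero_add, mul_one, min_eq_right hb] at this

end RealRAM

/-! ## The sweep on the real RAM -/

namespace RealRAM

def suffixInit : Program :=
  .seq (.setNat 7 (.sub (.reg 0) (.const 1)))
  (.seq (.putReal 4 (.reg 7) (.get 1 (.reg 7)))
    (.putReal 5 (.reg 7) (.get 1 (.reg 7))))

def suffixStep : Program :=
  .seq (.setNat 7 (.sub (.reg 7) (.const 1)))
  (.seq (setMax 3 (.get 4 (.add (.reg 7) (.const 1))) (.get 1 (.reg 7)))
  (.seq (.putReal 4 (.reg 7) (.reg 3))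
  (.seq (setMin 3 (.get 5 (.add (.reg 7) (.const 1))) (.get 1 (.reg 7)))
    (.putReal 5 (.reg 7) (.reg 3)))))

def suffixLoop : Program := .whileDo (lessThan (.const 0) (.reg 7)) suffixStep

/-- Computes the maxima and minima of the ordinates of the points from `k` on, for all `k`. -/
def suffixExtrema : Program := .seq suffixInit suffixLoop

theorem runs_suffixExtrema {W n : ℕ} {s : State} (hW : n ≤ W) (hn : s.natReg 0 = n)
    (hn0 : 0 < n) :
    ∃ t s', Runs W suffixExtrema s t s' ∧ t ≤ 60 * n + 30 ∧ s'.natReg 0 = n ∧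
      s'.source = s.source ∧
      IsSuffixExtrema n 0 (fun k => (s.source k).2) (s'.realArr 4) (s'.realArr 5) := by
  have hsafe : suffixInit.Safe W s := by
    simp [suffixInit, hn]
    omega
  obtain ⟨t₁, ht₁, hr₁⟩ := suffixInit.runs_exec hsafe
  set s₁ := suffixInit.exec s with hs₁
  have h7 : s₁.natReg 7 = n - 1 := by simp [hs₁, suffixInit, hn]
  obtain ⟨t, s', hr, ⟨h0, hsrc, -, hext⟩, hb, ht⟩ := runs_whileDo (W := W)
    (b := lessThan (.const 0) (.reg 7)) (P := suffixStep)
    (fun s' => s'.natReg 0 = n ∧ s'.source = s.source ∧ s'.natReg 7 < n ∧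
      IsSuffixExtrema n (s'.natReg 7) (fun k => (s.source k).2) (s'.realArr 4) (s'.realArr 5))
    (fun s' => 60 * s'.natReg 7)
    (by
      rintro s' ⟨h0, hsrc, hlt, hext⟩ hb
      simp only [holds_lessThan, NatExpr.eval] at hb
      have hsafe : suffixStep.Safe W s' := by
        simp [suffixStep]
        omega
      obtain ⟨t, ht, hr⟩ := suffixStep.runs_exec hsafe
      obtain ⟨m, hm⟩ : ∃ m, s'.natReg 7 = m + 1 := ⟨s'.natReg 7 - 1, by omega⟩
      refine ⟨t, _, hr, ⟨?_, ?_, ?_, ?_⟩, ?_⟩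
      · simpa [suffixStep] using h0
      · rw [← hsrc]
        funext k
        simp [suffixStep, State.source]
      · simp [suffixStep]
        omega
      · rw [hm] at hext hlt
        have hy : (s.source m).2 = s'.realArr 1 m := by rw [← hsrc]; rfl
        have := hext.pred hlt
        simp only [hy] at this
        simpa [suffixStep, hm] using this
      · have : suffixStep.bound ≤ 50 := by decide
        have : (lessThan (.const 0) (.reg 7)).cost = 5 := by decide
        simp [suffixStep]
        omega)
    (s := s₁)
    ⟨by simp [hs₁, suffixInit, hn], by funext k; simp [hs₁, suffixInit, State.source],
      by omega, by
        rw [h7]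
        exact IsSuffixExtrema.last hn0 (by simp [hs₁, suffixInit, hn, State.source])
          (by simp [hs₁, suffixInit, hn, State.source])⟩
  have hk : s'.natReg 7 = 0 := by simpa using hb
  rw [hk] at hext
  refine ⟨_, _, .seq _ _ _ _ _ _ _ hr₁ hr, ?_, h0, hsrc, hext⟩
  have : suffixInit.bound ≤ 20 := by decide
  have : (lessThan (.const 0) (.reg 7)).cost = 5 := by decide
  omega

/-- Cell `n` of arrays `4` and `5` receives the default for an empty suffix: the overall minimum in
the array of maxima, and vice versa. The lookup at index `j + 1` then needs no case distinction. -/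
def sweepInit : Program :=
  .seq (.putReal 4 (.reg 0) (.get 5 (.const 0)))
  (.seq (.putReal 5 (.reg 0) (.get 4 (.const 0)))
  (.seq (.setReal 0 (.div (.add (.get 0 (.const 0)) (.get 0 (.sub (.reg 0) (.const 1))))
    (.const 2)))
  (.seq (.setReal 1 (.const 0))
  (.seq (.setReal 2 (.sub (.get 0 (.sub (.reg 0) (.const 1))) (.get 0 (.const 0))))
  (.seq (.setReal 3 (.get 5 (.const 0)))
  (.seq (.setReal 4 (.get 4 (.const 0)))
  (.seq (.setNat 5 (.const 0))
    (.setNat 6 (.const 0)))))))))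

/-- Computes the width for the window from register `5` to register `6`. -/
def sweepWidth : Program :=
  .seq (.setReal 5 (.sub (.get 0 (.reg 6)) (.get 0 (.reg 5))))
  (.seq (setMax 6 (.reg 3) (.get 4 (.add (.reg 6) (.const 1))))
  (.seq (setMin 7 (.reg 4) (.get 5 (.add (.reg 6) (.const 1))))
  (.seq (.setReal 8 (.sub (.reg 6) (.reg 7)))
    (setMax 9 (.reg 5) (.reg 8)))))

def sweepImprove : Program :=
  .ifThenElse (.realLE (.reg 2) (.reg 9)) .skip
    (.seq (.setReal 0 (.div (.add (.get 0 (.reg 5)) (.get 0 (.reg 6))) (.const 2)))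
    (.seq (.setReal 1 (.div (.add (.reg 6) (.reg 7)) (.const 2)))
      (.setReal 2 (.reg 9))))

def sweepAdvance : Program :=
  .ifThenElse (.realLE (.reg 8) (.reg 5))
    (.seq (setMax 3 (.reg 3) (.get 1 (.reg 5)))
    (.seq (setMin 4 (.reg 4) (.get 1 (.reg 5)))
      (.setNat 5 (.add (.reg 5) (.const 1)))))
    (.setNat 6 (.add (.reg 6) (.const 1)))

def sweepStep : Program := .seq sweepWidth (.seq sweepImprove sweepAdvance)

def sweepLoop : Program :=
  .whileDo (.conj (lessThan (.reg 5) (.reg 0)) (lessThan (.reg 6) (.reg 0))) sweepStep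

/-- The registers and arrays during the sweep: the extrema of the points before register `5` are
in the real registers `3` and `4`, those of the points from `k` on in cell `k` of the real arrays
`4` and `5`. -/
structure SweepState (n : ℕ) (A : ℕ → ℝ × ℝ) (U L : ℕ → ℝ) (s : State) : Prop where
  size : s.natReg 0 = n
  source : s.source = A
  upper : ∀ j < n, s.realArr 4 (j + 1) = if j + 1 < n then U (j + 1) else L 0
  lower : ∀ j < n, s.realArr 5 (j + 1) = if j + 1 < n then L (j + 1) else U 0
  maxBefore : s.realReg 3 = prefixMax (L 0) (fun k => (A k).2) (s.natReg 5)
  minBefore : s.realReg 4 = prefixMin (U 0) (fun k => (A k).2) (s.natReg 5)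

/-- The sweep invariant for the contents of the registers. -/
def SweepInvAt (n : ℕ) (A : ℕ → ℝ × ℝ) (top bot : ℕ → ℕ → ℝ) (s : State) : Prop :=
  SweepInv n A top bot (s.natReg 5) (s.natReg 6) (s.realReg 0) (s.realReg 1) (s.realReg 2)

/-- The registers `5` to `9` describe the current window. -/
structure WindowState (A : ℕ → ℝ × ℝ) (top bot : ℕ → ℕ → ℝ) (s : State) : Prop where
  spread : s.realReg 5 = (A (s.natReg 6)).1 - (A (s.natReg 5)).1
  top : s.realReg 6 = top (s.natReg 5) (s.natReg 6)
  bot : s.realReg 7 = bot (s.natReg 5) (s.natReg 6)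
  height : s.realReg 8 = s.realReg 6 - s.realReg 7
  width : s.realReg 9 = max (s.realReg 5) (s.realReg 8)

section Step

variable {n : ℕ} {A : ℕ → ℝ × ℝ} {U L : ℕ → ℝ} {top bot : ℕ → ℕ → ℝ} {s : State}

theorem SweepState.exec_sweepWidth (h : SweepState n A U L s) :
    SweepState n A U L (sweepWidth.exec s) where
  size := by simpa [sweepWidth] using h.size
  source := by
    rw [← h.source]
    funext k
    simp [sweepWidth, State.source]
  upper j hj := by simpa [sweepWidth] using h.upper j hj
  lower j hj := by simpa [sweepWidth] using h.lower j hj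
  maxBefore := by simpa [sweepWidth] using h.maxBefore
  minBefore := by simpa [sweepWidth] using h.minBefore

theorem SweepState.windowState (h : SweepState n A U L s) (hj : s.natReg 6 < n) :
    WindowState A (topAround n A U L) (botAround n A U L) (sweepWidth.exec s) where
  spread := by simp [sweepWidth, ← h.source, State.source]
  top := by simp [sweepWidth, topAround, h.upper _ hj, h.maxBefore]
  bot := by simp [sweepWidth, botAround, h.lower _ hj, h.minBefore]
  height := by simp [sweepWidth]
  width := by simp [sweepWidth]

theorem WindowState.spanWidth_eq (h : WindowState A top bot s) :
    spanWidth A top bot (s.natReg 5) (s.natReg 6) = s.realReg 9 := by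
  rw [spanWidth, h.width, h.height, h.spread, h.top, h.bot]

/-- After a possible improvement, the current best is at most the width of the current window, which
both ways of advancing require. -/
theorem exec_sweepImprove (hS : SweepState n A U L s) (hw : WindowState A top bot s)
    (h : SweepInvAt n A top bot s) (hA : SortedOn A 0 n) (hE : IsEnvelope n A top bot)
    (hj : s.natReg 6 < n) :
    SweepState n A U L (sweepImprove.exec s) ∧ WindowState A top bot (sweepImprove.exec s) ∧
      SweepInvAt n A top bot (sweepImprove.exec s) ∧
      (sweepImprove.exec s).realReg 2 ≤ (sweepImprove.exec s).realReg 9 ∧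
      (sweepImprove.exec s).natReg = s.natReg := by
  by_cases ht : (Test.realLE (.reg 2) (.reg 9)).Holds s
  · rw [sweepImprove, Program.exec, if_pos ht, Program.exec]
    exact ⟨hS, hw, h, ht, rfl⟩
  · rw [sweepImprove, Program.exec, if_neg ht]
    refine ⟨⟨?_, ?_, fun j hj => ?_, fun j hj => ?_, ?_, ?_⟩, ⟨?_, ?_, ?_, ?_, ?_⟩, ?_, ?_, ?_⟩
    · simpa using hS.size
    · rw [← hS.source]
      funext k
      simp [State.source]
    · simpa using hS.upper j hj
    · simpa using hS.lower j hj
    · simpa using hS.maxBefore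
    · simpa using hS.minBefore
    · simpa using hw.spread
    · simpa using hw.top
    · simpa using hw.bot
    · simpa using hw.height
    · simpa using hw.width
    · have := h.improve hA hE hj (by rw [hw.spanWidth_eq]; exact not_le.1 ht)
      rw [hw.spanWidth_eq, ← hw.top, ← hw.bot, ← hS.source] at this
      simpa [SweepInvAt, State.source, ← hS.source] using this
    · simp
    · simp

theorem exec_sweepAdvance (hS : SweepState n A U L s) (hw : WindowState A top bot s)
    (h : SweepInvAt n A top bot s) (hA : SortedOn A 0 n) (hE : IsEnvelope n A top bot)
    (hi : s.natReg 5 < n) (hj : s.natReg 6 < n) (hr : s.realReg 2 ≤ s.realReg 9) :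
    SweepState n A U L (sweepAdvance.exec s) ∧ SweepInvAt n A top bot (sweepAdvance.exec s) ∧
      (sweepAdvance.exec s).natReg 5 + (sweepAdvance.exec s).natReg 6 =
        s.natReg 5 + s.natReg 6 + 1 := by
  rw [← hw.spanWidth_eq] at hr
  by_cases ht : (Test.realLE (.reg 8) (.reg 5)).Holds s
  · rw [sweepAdvance, Program.exec, if_pos ht]
    have hle : s.realReg 8 ≤ s.realReg 5 := ht
    rw [hw.height, hw.spread, hw.top, hw.bot] at hle
    refine ⟨⟨?_, ?_, fun j hj => ?_, fun j hj => ?_, ?_, ?_⟩, ?_, ?_⟩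
    · simpa using hS.size
    · rw [← hS.source]
      funext k
      simp [State.source]
    · simpa using hS.upper j hj
    · simpa using hS.lower j hj
    · simp [hS.maxBefore, prefixMax]
      simp [← hS.source, State.source]
    · simp [hS.minBefore, prefixMin]
      simp [← hS.source, State.source]
    · simpa [SweepInvAt] using h.advance_left hA hi hr hle
    · simp
      omega
  · rw [sweepAdvance, Program.exec, if_neg ht]
    have hle : s.realReg 5 ≤ s.realReg 8 := (not_le.1 ht).le
    rw [hw.height, hw.spread, hw.top, hw.bot] at hle
    refine ⟨⟨?_, ?_, fun j hj => ?_, fun j hj => ?_, ?_, ?_⟩, ?_, ?_⟩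
    · simpa using hS.size
    · rw [← hS.source]
      funext k
      simp [State.source]
    · simpa using hS.upper j hj
    · simpa using hS.lower j hj
    · simpa using hS.maxBefore
    · simpa using hS.minBefore
    · simpa [SweepInvAt] using h.advance_right hE hj hr hle
    · simp
      omega

end Step

theorem safe_sweepStep {W : ℕ} {s : State} (h5 : s.natReg 5 < W) (h6 : s.natReg 6 < W) :
    sweepStep.Safe W s := by
  refine ⟨by simp [sweepWidth], by simp [sweepImprove], ?_⟩
  have h : (sweepImprove.exec (sweepWidth.exec s)).natReg = s.natReg := by
    by_cases ht : (Test.realLE (.reg 2) (.reg 9)).Holds (sweepWidth.exec s)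
    · rw [sweepImprove, Program.exec, if_pos ht]
      simp [sweepWidth]
    · rw [sweepImprove, Program.exec, if_neg ht]
      simp [sweepWidth]
  simp [sweepAdvance, h]
  omega

/-- Computes a smallest enclosing cross of the sorted source points. -/
def sweep : Program := .seq suffixExtrema (.seq sweepInit sweepLoop)

theorem runs_sweep {W n : ℕ} {s : State} (hW : n ≤ W) (hn : s.natReg 0 = n)
    (hn0 : 0 < n) (hA : SortedOn s.source 0 n) :
    ∃ t s' C, Runs W sweep s t s' ∧ t ≤ 500 * n + 200 ∧ Outputs s' C ∧
      C.IsSmallestEnclosing (s.source '' Set.Ico 0 n) := by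
  obtain ⟨t₁, s₁, hr₁, ht₁, h0, hsrc, hext⟩ := runs_suffixExtrema hW hn hn0
  have hE := hext.isEnvelope hn0
  set A := s.source with hAdef
  set U := s₁.realArr 4 with hU
  set L := s₁.realArr 5 with hL
  obtain ⟨t₂, ht₂, hr₂⟩ := sweepInit.runs_exec (W := W) (s := s₁) (by simp [sweepInit, h0, hW])
  set s₂ := sweepInit.exec s₁ with hs₂
  obtain ⟨t₃, s₃, hr₃, ⟨hS, hI⟩, hb, ht₃⟩ := runs_whileDo (W := W)
    (b := .conj (lessThan (.reg 5) (.reg 0)) (lessThan (.reg 6) (.reg 0))) (P := sweepStep)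
    (fun s' => SweepState n A U L s' ∧ SweepInvAt n A (topAround n A U L) (botAround n A U L) s')
    -- Each iteration advances exactly one of the two pointers, so their sum grows by one.
    (fun s' => 200 * (2 * n - (s'.natReg 5 + s'.natReg 6)))
    (by
      rintro s' ⟨hS, hI⟩ hb
      simp only [Test.Holds, holds_lessThan, NatExpr.eval, hS.size] at hb
      obtain ⟨t, ht, hr⟩ := sweepStep.runs_exec (W := W) (s := s')
        (safe_sweepStep (by omega) (by omega))
      have hreg : (sweepWidth.exec s').natReg = s'.natReg := by simp [sweepWidth]
      have hI₁ : SweepInvAt n A (topAround n A U L) (botAround n A U L)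
          (sweepWidth.exec s') := by
        simpa [SweepInvAt, sweepWidth] using hI
      obtain ⟨hS₂, hw₂, hI₂, hle, hreg₂⟩ := exec_sweepImprove hS.exec_sweepWidth
        (hS.windowState hb.2) hI₁ hA hE (by rw [hreg]; exact hb.2)
      rw [hreg] at hreg₂
      obtain ⟨hS₃, hI₃, hsum⟩ := exec_sweepAdvance hS₂ hw₂ hI₂ hA hE (by rw [hreg₂]; exact hb.1)
        (by rw [hreg₂]; exact hb.2) hle
      refine ⟨t, _, hr, ⟨hS₃, hI₃⟩, ?_⟩
      rw [hreg₂] at hsum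
      change 1 + _ + t + 200 * (2 * n - ((sweepAdvance.exec _).natReg 5 +
        (sweepAdvance.exec _).natReg 6)) ≤ _
      rw [hsum]
      have : sweepStep.bound ≤ 150 := by decide
      have : (Test.conj (lessThan (.reg 5) (.reg 0)) (lessThan (.reg 6) (.reg 0))).cost = 11 := by
        decide
      omega)
    (s := s₂)
    ⟨⟨by simp [hs₂, sweepInit, h0], by
      rw [← hsrc]; funext k; simp [hs₂, sweepInit, State.source], fun j hj => by
      by_cases hjn : j + 1 < n
      · simp [hs₂, sweepInit, h0, hjn, hjn.ne, hU]
      · obtain rfl : n = j + 1 := by omega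
        simp [hs₂, sweepInit, h0, hL], fun j hj => by
      by_cases hjn : j + 1 < n
      · simp [hs₂, sweepInit, h0, hjn, hjn.ne, hL]
      · obtain rfl : n = j + 1 := by omega
        simp [hs₂, sweepInit, h0, hU],
      by simp [hs₂, sweepInit, h0, prefixMax, hn0.ne, hL],
      by simp [hs₂, sweepInit, h0, prefixMin, hn0.ne, hU]⟩, by
      have := SweepInv.of_span (top := topAround n A U L) (bot := botAround n A U L) hA hn0
      have hx : ∀ k, s₁.realArr 0 k = (A k).1 := fun k => congrArg Prod.fst (congrFun hsrc k)
      simpa [SweepInvAt, hs₂, sweepInit, h0, hx] using this⟩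
  simp only [Test.Holds, holds_lessThan, NatExpr.eval, hS.size, not_and_or, not_lt] at hb
  refine ⟨_, s₃, ⟨⟨s₃.realReg 0, s₃.realReg 1⟩, ⟨s₃.realReg 2, hI.nonneg hn0⟩⟩,
    .seq _ _ _ _ _ _ _ hr₁ (.seq _ _ _ _ _ _ _ hr₂ hr₃), ?_, ⟨rfl, rfl, rfl⟩,
    hI.isSmallestEnclosing hE hn0 hb rfl⟩
  have : sweepInit.bound ≤ 80 := by decide
  have : (Test.conj (lessThan (.reg 5) (.reg 0)) (lessThan (.reg 6) (.reg 0))).cost = 11 := by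
    decide
  have : 2 * n - (s₂.natReg 5 + s₂.natReg 6) ≤ 2 * n := Nat.sub_le _ _
  omega

/-- Computes a smallest enclosing cross of the source points. -/
def smallestCross : Program := .seq sort sweep

theorem runs_smallestCross {n : ℕ} (hn : 2 ≤ n) (q : Fin n → ℝ × ℝ) :
    ∃ t s C, Runs (4000 * n) smallestCross (inputState q) t s ∧
      (t : ℝ) ≤ (4000 : ℕ) * (n * Real.log n) ∧ Outputs s C ∧
      C.IsSmallestEnclosing (Set.range q) := by
  obtain ⟨t₁, s₁, hr₁, ht₁, h0, hsort, himg⟩ := runs_sort (W := 4000 * n) (n := n)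
    (s := inputState q) (by omega) (by simp [inputState]) (by omega)
  obtain ⟨t₂, s₂, C, hr₂, ht₂, hout, hC⟩ := runs_sweep (W := 4000 * n) (by omega) h0 (by omega)
    hsort
  have hrange : (inputState q).source '' Set.Ico 0 n = Set.range q := by
    ext z
    constructor
    · rintro ⟨k, hk, rfl⟩
      exact ⟨⟨k, hk.2⟩, by simp [inputState, State.source, hk.2]⟩
    · rintro ⟨k, rfl⟩
      exact ⟨k, ⟨Nat.zero_le _, k.2⟩, by simp [inputState, State.source]⟩
  rw [himg, hrange] at hC
  refine ⟨_, s₂, C, .seq _ _ _ _ _ _ _ hr₁ hr₂, ?_, hout, hC⟩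
  -- For `n ≥ 2` the binary logarithm is at least `1`, which absorbs rounding up here and the linear
  -- and constant terms below.
  have hclog : Nat.clog 2 n ≤ 2 * Nat.log 2 n := by
    have h1 : Nat.clog 2 n ≤ Nat.log 2 n + 1 :=
      Nat.clog_le_of_le_pow (Nat.lt_pow_succ_log_self one_lt_two n).le
    have h2 : 1 ≤ Nat.log 2 n := Nat.log_pos one_lt_two hn
    omega
  have hl1 : 1 ≤ Nat.log 2 n := Nat.log_pos one_lt_two hn
  have ht : t₁ + t₂ ≤ 1400 * (n * Nat.log 2 n) := by
    have h1 : 300 * n * Nat.clog 2 n ≤ 600 * (n * Nat.log 2 n) := by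
      calc 300 * n * Nat.clog 2 n ≤ 300 * n * (2 * Nat.log 2 n) := Nat.mul_le_mul_left _ hclog
        _ = 600 * (n * Nat.log 2 n) := by ring
    have h2 : n ≤ n * Nat.log 2 n := Nat.le_mul_of_pos_right n hl1
    omega
  -- The factor `2` is available because `Real.log 2 > 1 / 2`.
  have hlog : (Nat.log 2 n : ℝ) ≤ 2 * Real.log n := by
    have h1 := Real.natLog_le_logb n 2
    rw [Real.logb, Nat.cast_ofNat, le_div_iff₀ (Real.log_pos one_lt_two)] at h1
    have h2 := Real.log_two_gt_d9
    nlinarith [Nat.cast_nonneg (α := ℝ) (Nat.log 2 n)]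
  calc ((t₁ + t₂ : ℕ) : ℝ) ≤ ((1400 * (n * Nat.log 2 n) : ℕ) : ℝ) := Nat.cast_le.2 ht
    _ = 1400 * (n * (Nat.log 2 n : ℝ)) := by push_cast; ring
    _ ≤ 1400 * (n * (2 * Real.log n)) := by gcongr
    _ ≤ (4000 : ℕ) * (n * Real.log n) := by
      have : 0 ≤ n * Real.log n := mul_nonneg (Nat.cast_nonneg _) (Real.log_natCast_nonneg n)
      push_cast
      linarith

end RealRAM

/-! ## The main theorem -/

theorem StripCross.exists_isSmallestEnclosing {S : Set (ℝ × ℝ)} (hS : S.Finite) :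
    ∃ C : StripCross, C.IsSmallestEnclosing S := by
  rcases S.eq_empty_or_nonempty with rfl | ⟨z, hz⟩
  · exact ⟨⟨⟨0, 0⟩, 0⟩, Set.empty_subset _, fun _ _ => bot_le⟩
  obtain ⟨n, f, hf⟩ := hS.fin_embedding
  -- The program's output is the witness. Two extra copies of `z` bring the input to the required
  -- length of at least `2` without changing its range.
  obtain ⟨-, -, C, -, -, -, hC⟩ := RealRAM.runs_smallestCross (n := n + 2) (by omega)
    (fun k => if hk : k < n then f ⟨k, hk⟩ else z)
  refine ⟨C, ?_⟩
  convert hC using 1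
  ext w
  constructor
  · rw [← hf]
    rintro ⟨k, rfl⟩
    exact ⟨⟨k, by omega⟩, by simp⟩
  · rintro ⟨k, rfl⟩
    dsimp only
    split_ifs
    · exact hf ▸ Set.mem_range_self _
    · exact hz

theorem mainTheorem5 :
    (∀ (p : ℝ≥0∞) [Fact (1 ≤ p)] (S : Set (ℝ × ℝ)), S.Finite →
      (∃ C : StripCross, C.IsSmallestEnclosing S) ∧
      (∃ h : HighwayCross, h.IsOptimal p ∞ S) ∧
      (∀ (C : StripCross) (h : HighwayCross), C.IsSmallestEnclosing S → h.IsOptimal p ∞ S →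
        h.travelTimeDiameter p ∞ S = (C.width : ℝ≥0∞)) ∧
      (∀ C : StripCross, C.IsSmallestEnclosing S → C.mid.IsOptimal p ∞ S)) ∧
    (∃ (P : RealRAM.Program) (K : ℕ), ∀ (n : ℕ), 2 ≤ n → ∀ q : Fin n → ℝ × ℝ,
      ∃ (t : ℕ) (s : RealRAM.State) (C : StripCross),
        RealRAM.Runs (K * n) P (RealRAM.inputState q) t s ∧
        (t : ℝ) ≤ K * (n * Real.log n) ∧
        RealRAM.Outputs s C ∧
        C.IsSmallestEnclosing (Set.range q) ∧
        ∀ (p : ℝ≥0∞) [Fact (1 ≤ p)], C.mid.IsOptimal p ∞ (Set.range q) ∧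
          C.mid.travelTimeDiameter p ∞ (Set.range q) = (C.width : ℝ≥0∞)) := by
  refine ⟨fun p _ S hS => ?_, RealRAM.smallestCross, 4000, fun n hn q => ?_⟩
  · obtain ⟨C, hC⟩ := StripCross.exists_isSmallestEnclosing hS
    refine ⟨⟨C, hC⟩, ⟨C.mid, hC.isOptimal p hS⟩, fun C h hC hh => ?_, fun C hC =>
      hC.isOptimal p hS⟩
    exact le_antisymm ((hh C.mid).trans_eq (hC.diameter_eq_width p hS))
      (hC.width_le_diameter p hS h)
  · obtain ⟨t, s, C, hr, ht, hout, hC⟩ := RealRAM.runs_smallestCross hn q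
    exact ⟨t, s, C, hr, ht, hout, hC, fun p _ =>
      ⟨hC.isOptimal p (Set.finite_range q), hC.diameter_eq_width p (Set.finite_range q)⟩⟩
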